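/- Let $\mathcal S$ be an (essentially small) triangulated category with suspension $\Sigma$. A \emph{metric} on $\mathcal S$ is a sequence of full additive subcategories $\{\mathcal M_i\}_{i\in\mathbb N}$ with $\mathcal M_{i+1}\subset\mathcal M_i$ and $\mathcal M_i*\mathcal M_i=\mathcal M_i$ for all $i$, where $\mathcal A*\mathcal C$ consists of the objects $b$ for which there is a distinguished triangle $a\to b\to c\to\Sigma a$ with $a\in\mathcal A$, $c\in\mathcal C$. A sequence $E_1\to E_2\to E_3\to\cdots$ in $\mathcal S$ is \emph{Cauchy} if for every $i\in\mathbb N$ and $j\in\mathbb Z$ there is $M>0$ such that in every triangle $E_m\to E_{m'}\to D\to\Sigma E_m$ with $M\le m<m'$ one has $\Sigma^jD\in\mathcal M_i$. Let $\mathrm{Mod}\,\mathcal S$ be the category of additive functors $\mathcal S^{op}\to\mathrm{Ab}$, with $(\Sigma A)(s)=A(\Sigma^{-1}s)$, and $Y:\mathcal S\to\mathrm{Mod}\,\mathcal S$, $Y(A)=\mathrm{Hom}(-,A)$, the Yoneda functor. Define full subcategories of $\mathrm{Mod}\,\mathcal S$: $\mathfrak L(\mathcal S)$ consists of the colimits of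 $Y(E_*)$ for Cauchy sequences $E_*$; $\mathfrak C(\mathcal S)$ consists of the $A$ such that for every $j\in\mathbb Z$ there is $i$ with $\mathrm{Hom}(Y(\Sigma^j\mathcal M_i),A)=0$; and $\mathfrak S(\mathcal S)=\mathfrak L(\mathcal S)\cap\mathfrak C(\mathcal S)$. Declare a triangle $A\to B\to C\to\Sigma A$ in $\mathfrak S(\mathcal S)$ to be distinguished if it is isomorphic to the colimit of the image under $Y$ of a sequence of distinguished triangles $a_*\to b_*\to c_*\to\Sigma a_*$ of $\mathcal S$ in which $a_*,b_*,c_*$ are Cauchy. Let $F:\mathcal S\to\mathcal T$ be a \emph{good extension} with respect to the metric: $\mathcal T$ is a triangulated category with coproducts, $F$ is a fully faithful triangulated functor and, with $\mathcal Y:\mathcal T\to\mathrm{Mod}\,\mathcal S$, $\mathcal Y(A)=\mathrm{Hom}(F(-),A)$, the natural map $\mathrm{colim}\,Y(E_*)\to\mathcal Y(\mathrm{hocolim}\,F(E_*))$ is an isomorphism for every Cauchy sequence $E_*$ in $\mathcal S$. Let $\mathfrak L'(\mathcal S)\subset\mathcal T$ be the full subcategory of all objects isomorphic to $\mathrm{hocolim}\,F(E_*)$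 for some Cauchy sequence $E_*$ in $\mathcal S$. Then $\mathfrak L'(\mathcal S)\cap\mathcal Y^{-1}(\mathfrak C(\mathcal S))$ is a (strictly full) triangulated subcategory of $\mathcal T$; the category $\mathfrak S(\mathcal S)$ with the distinguished triangles above is triangulated; and $\mathcal Y$ restricts to a triangulated equivalence \[\mathcal Y:\ \mathfrak L'(\mathcal S)\cap\mathcal Y^{-1}(\mathfrak C(\mathcal S))\ \longrightarrow\ \mathfrak S(\mathcal S),\] where the left-hand side has the triangulated structure inherited from $\mathcal T$. -/

import Mathlib

open CategoryTheory Limits Pretriangulated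

namespace MetricCompletion

noncomputable section

universe v u u₁ u₂

section Shift

/-! ### The shift on categories of functors

Throughout, `Sᵒᵖ` carries the shift for which `⟦n⟧` on `Sᵒᵖ` is `⟦-n⟧` on `S`. -/

open scoped Pretriangulated.Opposite

section FunctorShift
variable {D : Type*} [Category* D] [HasShift D ℤ] (E : Type*) [Category* E]

lemma eqToHom_shift_aux {E : Type*} [Category* E] (A : D ⥤ E) (p p' a b : ℤ) (hp : p = p')
    (h : b + a = p') (x : D) (e : A.obj (x⟦p⟧) = A.obj (x⟦p'⟧)) :
    eqToHom e ≫ A.map ((shiftFunctorAdd' D b a p' h).hom.app x) =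
      A.map ((shiftFunctorAdd' D b a p (h.trans hp.symm)).hom.app x) := by
  subst hp
  simp

variable (D) in
/-- Precomposition with the shift functors of `D` defines a shift on `D ⥤ E`. -/
def precompShiftCore : ShiftMkCore (D ⥤ E) ℤ where
  F n := (Functor.whiskeringLeft D D E).obj (shiftFunctor D n)
  zero := (Functor.whiskeringLeft D D E).mapIso (shiftFunctorZero D ℤ)
  add a b := (Functor.whiskeringLeft D D E).mapIso
    (shiftFunctorAdd' D b a (a + b) (add_comm b a))
  assoc_hom_app a b c A := by
    ext x
    have h := shiftFunctorAdd'_assoc_hom_app c b a (b + c) (a + b) (a + b + c)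
      (add_comm _ _) (add_comm _ _) (by abel) x
    have h' := congrArg A.map h
    simp only [Functor.map_comp] at h'
    simp only [NatTrans.comp_app, eqToHom_app]
    erw [reassoc_of% (eqToHom_shift_aux A (a + b + c) (a + (b + c)) a (b + c) (add_assoc _ _ _)
      (add_comm _ _) x (by rw [add_assoc]))]
    exact h'.symm
  zero_add_hom_app n A := by
    ext x
    simp only [NatTrans.comp_app, eqToHom_app]
    have h := congrArg A.map (shiftFunctorAdd'_add_zero_hom_app n x)
    have := eqToHom_shift_aux A (0 + n) n 0 n (zero_add n) (add_zero n) x (by rw [zero_add])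
    rw [h] at this
    exact this.symm
  add_zero_hom_app n A := by
    ext x
    simp only [NatTrans.comp_app, eqToHom_app]
    have h := congrArg A.map (shiftFunctorAdd'_zero_add_hom_app n x)
    have := eqToHom_shift_aux A (n + 0) n n 0 (add_zero n) (zero_add n) x (by rw [add_zero])
    rw [h] at this
    exact this.symm

/-- The shift on `D ⥤ E` with `A⟦n⟧ = A ∘ (-⟦n⟧)`. -/
@[reducible]
def precompShift : HasShift (D ⥤ E) ℤ := hasShiftMk _ _ (precompShiftCore D E)

end FunctorShift

section Pre

attribute [local instance] precompShift
variable {D D' : Type*} [Category* D] [HasShift D ℤ] [Category* D'] [HasShift D' ℤ]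
  (E : Type*) [Category* E] (G : D ⥤ D') [G.CommShift ℤ]

/-- Precomposition with a functor commuting with shifts commutes with shifts. -/
instance : ((Functor.whiskeringLeft D D' E).obj G).CommShift ℤ where
  commShiftIso n := (Functor.whiskeringLeft D D' E).mapIso (G.commShiftIso n).symm
  commShiftIso_zero := by
    ext A x
    have := congrArg A.map (congrArg (fun e => e.inv.app x) (G.commShiftIso_zero ℤ))
    simp only [Functor.CommShift.isoZero_inv_app, Functor.map_comp] at this
    simp only [Functor.CommShift.isoZero_hom_app]
    exact this
  commShiftIso_add a b := by
    ext A x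
    have := congrArg A.map (congrArg (fun e => e.inv.app x) (G.commShiftIso_add' (add_comm b a)))
    simp only [Functor.CommShift.isoAdd'_inv_app, Functor.map_comp] at this
    refine Eq.trans ?_ (congrArg (fun f : ((Functor.whiskeringLeft D D' E).obj G).obj (A⟦a + b⟧) ⟶
      (((Functor.whiskeringLeft D D' E).obj G).obj A)⟦a + b⟧ => f.app x)
      (Functor.CommShift.isoAdd_hom_app _ _ A)).symm
    refine this.trans ?_
    rfl
end Pre

section Yon

variable (S : Type u) [Category.{v} S] [HasShift S ℤ]

/-- The shift on contravariant functors: `(A⟦n⟧)(s) = A(s⟦-n⟧)`. -/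
instance : HasShift (Sᵒᵖ ⥤ AddCommGrpCat.{v}) ℤ := precompShift _

variable {T : Type u} [Category.{v} T] [Preadditive T] [HasShift T ℤ]
  [∀ n : ℤ, (shiftFunctor T n).Additive]

/-- The bijection `Hom(s⟦-n⟧, A) ≃ Hom(s, A⟦n⟧)` (recall that `s⟦n⟧` in `Tᵒᵖ` is `s⟦-n⟧` in `T`). -/
def yonedaShiftEquiv (A : T) (n : ℤ) (s : Tᵒᵖ) :
    (((s⟦n⟧ : Tᵒᵖ).unop ⟶ A)) ≃+ (s.unop ⟶ A⟦n⟧) where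
  toEquiv := Quiver.Hom.opEquiv.trans (ShiftedHom.opEquiv n).symm
  map_add' _ _ := ShiftedHom.opEquiv_symm_add _ _


/-- The natural isomorphisms `Hom(-, A⟦n⟧) ≅ Hom(-, A)⟦n⟧`. -/
instance : (preadditiveYoneda (C := T)).CommShift ℤ where
  commShiftIso n := (NatIso.ofComponents (fun A => NatIso.ofComponents
    (fun s => (yonedaShiftEquiv A n s).toAddCommGrpIso) (by
     intro s s' f
     ext (g : (s⟦n⟧ : Tᵒᵖ).unop ⟶ A)
     change (ShiftedHom.opEquiv n).symm (g.op ≫ f⟦n⟧') = f.unop ≫ (ShiftedHom.opEquiv n).symm g.op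
     rw [ShiftedHom.opEquiv_symm_apply, ShiftedHom.opEquiv_symm_apply]
     apply Quiver.Hom.op_inj
     simp)) (by
     intro A A' f
     ext s (g : (s⟦n⟧ : Tᵒᵖ).unop ⟶ A)
     change (ShiftedHom.opEquiv n).symm (f.op ≫ g.op) = (ShiftedHom.opEquiv n).symm g.op ≫ f⟦n⟧'
     rw [ShiftedHom.opEquiv_symm_apply, ShiftedHom.opEquiv_symm_apply]
     simp)).symm
  commShiftIso_zero := by
    apply Iso.symm_eq_iff.1
    ext A s (g : (s⟦(0:ℤ)⟧ : Tᵒᵖ).unop ⟶ A)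
    refine Eq.trans ?_ (congrArg (fun f : (preadditiveYoneda.obj A)⟦(0 : ℤ)⟧ ⟶
      preadditiveYoneda.obj (A⟦(0 : ℤ)⟧) => (f.app s).hom g)
      (Functor.CommShift.isoZero_inv_app preadditiveYoneda ℤ A)).symm
    change (ShiftedHom.opEquiv 0).symm g.op =
      (((shiftFunctorZero Tᵒᵖ ℤ).hom.app s).unop ≫ g) ≫ (shiftFunctorZero T ℤ).inv.app A
    rw [ShiftedHom.opEquiv_symm_apply]
    have h := (shiftFunctorZero T ℤ).inv.naturality (((shiftFunctorZero Tᵒᵖ ℤ).hom.app s).unop ≫ g)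
    refine Eq.trans ?_ h.symm
    simp [opShiftFunctorEquivalence_zero_unitIso_inv_app]
  commShiftIso_add a b := by
    apply Iso.symm_eq_iff.1
    ext A s (g : (s⟦(a+b:ℤ)⟧ : Tᵒᵖ).unop ⟶ A)
    refine Eq.trans ?_ (congrArg (fun f : (preadditiveYoneda.obj A)⟦a + b⟧ ⟶
      preadditiveYoneda.obj (A⟦a + b⟧) => (f.app s).hom g)
      (Functor.CommShift.isoAdd_inv_app _ _ A)).symm
    change ((opShiftFunctorEquivalence T (a + b)).unitIso.inv.app s).unop ≫ g⟦a + b⟧' =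
      (((opShiftFunctorEquivalence T b).unitIso.inv.app s).unop ≫
        (((opShiftFunctorEquivalence T a).unitIso.inv.app (s⟦b⟧)).unop ≫
          (((shiftFunctorAdd' Tᵒᵖ b a (a + b) (add_comm b a)).hom.app s).unop ≫ g)⟦a⟧')⟦b⟧') ≫
      (shiftFunctorAdd T a b).inv.app A
    rw [opShiftFunctorEquivalence_add_unitIso_inv_app_eq _ a b (a + b)]
    have h := (shiftFunctorAdd T a b).inv.naturality
      (((shiftFunctorAdd' Tᵒᵖ b a (a+b) (add_comm b a)).hom.app s).unop ≫ g)
    dsimp at h ⊢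
    simp only [Functor.map_comp, Category.assoc, shiftFunctorAdd'_eq_shiftFunctorAdd] at h ⊢
    rw [h]

end Yon

section ModShift

variable (S : Type u) [Category.{v} S] [Preadditive S]

/-- `Mod S`: the category of additive functors from `Sᵒᵖ` to abelian groups. -/
abbrev ModCat := Sᵒᵖ ⥤+ AddCommGrpCat.{v}

variable [HasShift S ℤ] [∀ n : ℤ, (shiftFunctor S n).Additive]

instance (n : ℤ) : (shiftFunctor (Sᵒᵖ ⥤ AddCommGrpCat.{v}) n).Additive where
  map_add := rfl

/-- The shift of `Mod S` is the one of the functor category: `(A⟦n⟧)(s) = A(s⟦-n⟧)`. -/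
instance : (additiveFunctor Sᵒᵖ AddCommGrpCat.{v}).IsStableUnderShift ℤ where
  isStableUnderShiftBy n :=
    { le_shift := fun A (_ : A.Additive) =>
        inferInstanceAs (shiftFunctor Sᵒᵖ n ⋙ A).Additive }

end ModShift

section Yoneda

variable {S : Type u₁} [Category.{v} S] [Preadditive S]
  {T : Type u₂} [Category.{v} T] [Preadditive T] (F : S ⥤ T) [F.Additive]

variable (S) in
/-- The Yoneda functor `Y : S ⥤ Mod S`, `Y(A) = Hom(-, A)`. -/
def yonedaMod : S ⥤ ModCat S :=
  ObjectProperty.lift _ preadditiveYoneda (fun A => inferInstanceAs (preadditiveYoneda.obj A).Additive)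

/-- The functor `𝒴 : T ⥤ Mod S`, `𝒴(A) = Hom(F(-), A)`. -/
def restrictedYoneda : T ⥤ ModCat S :=
  ObjectProperty.lift _
    (preadditiveYoneda ⋙ (Functor.whiskeringLeft Sᵒᵖ Tᵒᵖ AddCommGrpCat.{v}).obj F.op)
    (fun A => inferInstanceAs (F.op ⋙ preadditiveYoneda.obj A).Additive)

/-- The natural transformation `Y ⟶ 𝒴 ∘ F` given by the maps `Hom(s, A) ⟶ Hom(F(s), F(A))`
(an isomorphism if `F` is fully faithful). -/
def yonedaToRestricted : yonedaMod S ⟶ F ⋙ restrictedYoneda F where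
  app A := ObjectProperty.homMk (preadditiveYonedaMap F A)
  naturality A B f := by
    ext s g
    exact F.map_comp g f

variable [HasShift S ℤ] [∀ n : ℤ, (shiftFunctor S n).Additive]
  [HasShift T ℤ] [∀ n : ℤ, (shiftFunctor T n).Additive] [F.CommShift ℤ]

instance : (yonedaMod S).CommShift ℤ :=
  ObjectProperty.instCommShiftFullSubcategoryLift (A := ℤ) (additiveFunctor Sᵒᵖ AddCommGrpCat.{v})
    preadditiveYoneda _

instance : (restrictedYoneda F).CommShift ℤ :=
  ObjectProperty.instCommShiftFullSubcategoryLift (A := ℤ) (additiveFunctor Sᵒᵖ AddCommGrpCat.{v})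
    (preadditiveYoneda ⋙ (Functor.whiskeringLeft Sᵒᵖ Tᵒᵖ AddCommGrpCat.{v}).obj F.op) _

instance : (yonedaMod S).Additive where
  map_add := by
    intros
    ext s g
    exact Preadditive.comp_add _ _ _ _ _ _

instance : (restrictedYoneda F).Additive where
  map_add := by
    intros
    ext s g
    exact Preadditive.comp_add _ _ _ _ _ _

end Yoneda

end Shift

section Metric

open scoped ZeroObject

variable (S : Type u) [Category.{v} S] [Preadditive S] [HasZeroObject S] [HasShift S ℤ]
  [∀ n : ℤ, (shiftFunctor S n).Additive] [Pretriangulated S]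

/-- A metric on a triangulated category `S`: a decreasing sequence of additive subcategories
`M i` with `M i * M i = M i`. -/
structure Metric where
  /-- the objects of the `i`-th subcategory -/
  obj : ℕ → ObjectProperty S
  containsZero : ∀ i, (obj i).ContainsZero
  closedUnderSums : ∀ i, (obj i).IsClosedUnderBinaryProducts
  succ_le : ∀ i, obj (i + 1) ≤ obj i
  star_self : ∀ i, (obj i).extensionProduct (obj i) = obj i

variable {S} (M : Metric S)

/-- A sequence `E 0 ⟶ E 1 ⟶ ⋯` is Cauchy if for all `i` and `j` there is an `N` such that in
any triangle `E m ⟶ E m' ⟶ D ⟶` with `N ≤ m < m'` the object `D⟦j⟧` lies in `M i`. -/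
def IsCauchy (E : ℕ ⥤ S) : Prop :=
  ∀ (i : ℕ) (j : ℤ), ∃ N : ℕ, ∀ (m m' : ℕ) (_ : N ≤ m) (h : m < m')
    (D : S) (g : E.obj m' ⟶ D) (δ : D ⟶ (E.obj m)⟦(1 : ℤ)⟧),
      Triangle.mk (E.map (homOfLE h.le)) g δ ∈ distTriang S → M.obj i (D⟦j⟧)

/-- `𝔏(S)`: the objects of `Mod S` which are colimits of Cauchy sequences of `S`. -/
def lim : ObjectProperty (ModCat S) := fun A =>
  ∃ E : ℕ ⥤ S, IsCauchy M E ∧ ∃ c : Cocone (E ⋙ yonedaMod S),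
    Nonempty (IsColimit c) ∧ Nonempty (A ≅ c.pt)

/-- `ℭ(S)`: the objects of `Mod S` which are compactly supported with respect to the metric. -/
def compactlySupported : ObjectProperty (ModCat S) := fun A =>
  ∀ j : ℤ, ∃ i : ℕ, ∀ m : S, M.obj i m → ∀ f : (yonedaMod S).obj (m⟦j⟧) ⟶ A, f = 0

/-- `𝔖(S) = 𝔏(S) ∩ ℭ(S)`. -/
def completion : ObjectProperty (ModCat S) := lim M ⊓ compactlySupported M

instance : (lim M).IsClosedUnderIsomorphisms where
  of_iso := by
    rintro A B e ⟨E, hE, c, hc, ⟨e'⟩⟩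
    exact ⟨E, hE, c, hc, ⟨e.symm ≪≫ e'⟩⟩

instance : (compactlySupported M).IsClosedUnderIsomorphisms where
  of_iso := by
    intro A B e hA j
    obtain ⟨i, hi⟩ := hA j
    refine ⟨i, fun m hm f => ?_⟩
    rw [← cancel_mono e.inv, zero_comp]
    exact hi m hm _

instance : (completion M).IsClosedUnderIsomorphisms := by
  unfold completion; infer_instance

lemma Metric.isClosedUnderIsomorphisms (i : ℕ) : (M.obj i).IsClosedUnderIsomorphisms := by
  rw [← M.star_self i]; infer_instance

lemma Metric.prop_of_isZero (i : ℕ) {X : S} (hX : IsZero X) : M.obj i X := by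
  have := M.containsZero i
  have := M.isClosedUnderIsomorphisms i
  exact (M.obj i).prop_of_isZero hX

instance : (completion M).ContainsZero where
  exists_zero := by
    have hZ : IsZero ((yonedaMod S).obj 0) := (yonedaMod S).map_isZero (isZero_zero S)
    refine ⟨_, hZ, ⟨(Functor.const ℕ).obj 0, ?_, ⟨_, 0⟩, ⟨⟨fun s => 0, ?_, ?_⟩⟩, ⟨Iso.refl _⟩⟩, ?_⟩
    · intro i j
      refine ⟨0, fun m m' _ h D g δ hD => M.prop_of_isZero i ?_⟩
      refine (shiftFunctor S j).map_isZero ?_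
      exact (Triangle.isZero₃_iff_isIso₁ _ hD).2 (inferInstanceAs (IsIso (𝟙 (0 : S))))
    · intro s n
      exact hZ.eq_of_src _ _
    · intro s f _
      exact hZ.eq_of_src _ _
    · intro j
      exact ⟨0, fun m _ f => hZ.eq_of_tgt _ _⟩

lemma IsCauchy.shift {E : ℕ ⥤ S} (hE : IsCauchy M E) (n : ℤ) :
    IsCauchy M (E ⋙ shiftFunctor S n) := by
  intro i j
  obtain ⟨N, hN⟩ := hE i (n + j)
  refine ⟨N, fun m m' hm h D g δ hD => ?_⟩
  obtain ⟨D', g', δ', hD'⟩ := distinguished_cocone_triangle (E.map (homOfLE h.le))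
  have hD'' := Triangle.shift_distinguished _ hD' n
  have := M.isClosedUnderIsomorphisms i
  let e := isoTriangleOfIso₁₂ _ _ hD hD'' (Iso.refl _) (n.negOnePow • Iso.refl _) (by
    change (E.map _)⟦n⟧' ≫ (n.negOnePow • Iso.refl ((E.obj m')⟦n⟧)).hom =
      𝟙 _ ≫ (n.negOnePow • (E.map _)⟦n⟧')
    rw [Preadditive.smul_iso_hom, Linear.comp_units_smul, Iso.refl_hom, Category.comp_id,
      Category.id_comp])
  exact (M.obj i).prop_of_iso ((shiftFunctorAdd S n j).app D' ≪≫
    (shiftFunctor S j).mapIso (Triangle.π₃.mapIso e).symm) (hN m m' hm h D' g' δ' hD')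

instance : (lim M).IsStableUnderShift ℤ where
  isStableUnderShiftBy n :=
    { le_shift := by
        rintro A ⟨E, hE, c, ⟨hc⟩, ⟨e⟩⟩
        exact ⟨E ⋙ shiftFunctor S n, hE.shift M n,
          (Cocone.precompose (Functor.isoWhiskerLeft E ((yonedaMod S).commShiftIso n)).hom).obj
            ((shiftFunctor (ModCat S) n).mapCocone c),
          ⟨(IsColimit.precomposeHomEquiv
            (Functor.isoWhiskerLeft E ((yonedaMod S).commShiftIso n)) _).symm
            (isColimitOfPreserves (shiftFunctor (ModCat S) n) hc)⟩,
          ⟨(shiftFunctor (ModCat S) n).mapIso e⟩⟩ }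

instance : (compactlySupported M).IsStableUnderShift ℤ where
  isStableUnderShiftBy n :=
    { le_shift := by
        intro A hA j
        obtain ⟨i, hi⟩ := hA (j - n)
        refine ⟨i, fun m hm f => ?_⟩
        let e : ((yonedaMod S).obj (m⟦j - n⟧))⟦n⟧ ≅ (yonedaMod S).obj (m⟦j⟧) :=
          ((yonedaMod S).commShiftIso n).symm.app (m⟦j - n⟧) ≪≫
            (yonedaMod S).mapIso ((shiftFunctorAdd' S (j - n) n j (by lia)).symm.app m)
        obtain ⟨g, hg⟩ := (shiftFunctor (ModCat S) n).map_surjective (e.hom ≫ f)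
        rw [← cancel_epi e.hom, ← hg, hi m hm g, Functor.map_zero, comp_zero] }

instance : (completion M).IsStableUnderShift ℤ := by
  unfold completion; infer_instance

/-- The distinguished triangles of `𝔖(S)`: the triangles which, in `Mod S`, are isomorphic to the
colimit of the image under `Y` of a Cauchy sequence of triangles of `S`. -/
def completionTriangles : Set (Triangle (completion M).FullSubcategory) := fun X =>
  ∃ K : ℕ ⥤ Triangle S, (∀ n, K.obj n ∈ distTriang S) ∧
    IsCauchy M (K ⋙ Triangle.π₁) ∧ IsCauchy M (K ⋙ Triangle.π₂) ∧ IsCauchy M (K ⋙ Triangle.π₃) ∧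
    ∃ c : Cocone (K ⋙ (yonedaMod S).mapTriangle),
      Nonempty (IsColimit (Triangle.π₁.mapCocone c)) ∧
      Nonempty (IsColimit (Triangle.π₂.mapCocone c)) ∧
      Nonempty (IsColimit (Triangle.π₃.mapCocone c)) ∧
      Nonempty ((completion M).ι.mapTriangle.obj X ≅ c.pt)

end Metric

section HomotopyColimit

variable {T : Type u} [Category.{v} T] [Preadditive T] [HasZeroObject T] [HasShift T ℤ]
  [∀ n : ℤ, (shiftFunctor T n).Additive] [Pretriangulated T]

/-- The endomorphism "shift" of a coproduct of the objects `X n`, which on the summand `X n` is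
the map `X n ⟶ X (n + 1)` of the sequence. -/
def shiftMap {X : ℕ ⥤ T} {c : Cofan X.obj} (hc : IsColimit c) : c.pt ⟶ c.pt :=
  Cofan.IsColimit.desc hc (fun n => X.map (homOfLE n.le_succ) ≫ c.inj (n + 1))

/-- A homotopy colimit of a sequence `X`: an object `pt` in a distinguished triangle
`∐ X n ⟶ ∐ X n ⟶ pt ⟶` whose first map is `1 - shift`. -/
structure HomotopyColimit (X : ℕ ⥤ T) where
  /-- the coproduct of the `X n` -/
  cofan : Cofan X.obj
  isColimit : IsColimit cofan
  /-- the homotopy colimit -/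
  pt : T
  /-- the projection from the coproduct -/
  π : cofan.pt ⟶ pt
  /-- the connecting map -/
  δ : pt ⟶ cofan.pt⟦(1 : ℤ)⟧
  distinguished : Triangle.mk (𝟙 cofan.pt - shiftMap isColimit) π δ ∈ distTriang T

/-- The canonical maps `X n ⟶ hocolim X`. -/
def HomotopyColimit.cocone {X : ℕ ⥤ T} (h : HomotopyColimit X) : Cocone X where
  pt := h.pt
  ι := NatTrans.ofSequence (fun n => h.cofan.inj n ≫ h.π) (by
    intro n
    have h₁ := comp_distTriang_mor_zero₁₂ _ h.distinguished
    change (𝟙 h.cofan.pt - shiftMap h.isColimit) ≫ h.π = 0 at h₁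
    have h₂ : h.cofan.inj n ≫ (𝟙 _ - shiftMap h.isColimit) ≫ h.π = 0 := by
      rw [h₁, comp_zero]
    have h₃ : h.cofan.inj n ≫ shiftMap h.isColimit =
        X.map (homOfLE n.le_succ) ≫ h.cofan.inj (n + 1) :=
      Cofan.IsColimit.fac _ _ _
    rw [Preadditive.sub_comp, Preadditive.comp_sub, Category.id_comp, ← Category.assoc, h₃,
      sub_eq_zero] at h₂
    simpa using h₂.symm)

end HomotopyColimit

section GoodExtension

variable {S : Type u₁} [Category.{v} S] [Preadditive S] [HasZeroObject S] [HasShift S ℤ]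
  [∀ n : ℤ, (shiftFunctor S n).Additive] [Pretriangulated S]
  {T : Type u₂} [Category.{v} T] [Preadditive T] [HasZeroObject T] [HasShift T ℤ]
  [∀ n : ℤ, (shiftFunctor T n).Additive] [Pretriangulated T]
  (M : Metric S) (F : S ⥤ T) [F.CommShift ℤ] [F.IsTriangulated]

/-- The cocone on `Y(E 0) ⟶ Y(E 1) ⟶ ⋯` with point `𝒴(hocolim F(E))`, with the natural maps
`Y(E n) ⟶ 𝒴(F(E n)) ⟶ 𝒴(hocolim F(E))`. -/
def comparisonCocone (E : ℕ ⥤ S) (h : HomotopyColimit (E ⋙ F)) : Cocone (E ⋙ yonedaMod S) :=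
  (Cocone.precompose (Functor.whiskerLeft E (yonedaToRestricted F))).obj
    ((restrictedYoneda F).mapCocone h.cocone)

/-- `F : S ⥤ T` is a good extension with respect to the metric `M`: it is fully faithful, and for
every Cauchy sequence `E` the natural map `colim Y(E) ⟶ 𝒴(hocolim F(E))` is an isomorphism, that is,
the natural maps `Y(E n) ⟶ 𝒴(hocolim F(E))` form a colimit cocone.
(That `F` is a triangulated functor and that `T` has coproducts are assumed separately.) -/
structure IsGoodExtension : Prop where
  full : F.Full
  faithful : F.Faithful
  isColimit : ∀ E : ℕ ⥤ S, IsCauchy M E → ∀ h : HomotopyColimit (E ⋙ F),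
    Nonempty (IsColimit (comparisonCocone F E h))

/-- `𝔏'(S)`: the isomorphs in `T` of homotopy colimits of images of Cauchy sequences of `S`. -/
def lim' : ObjectProperty T := fun A =>
  ∃ E : ℕ ⥤ S, IsCauchy M E ∧ ∃ h : HomotopyColimit (E ⋙ F), Nonempty (A ≅ h.pt)

/-- `𝔏'(S) ∩ 𝒴⁻¹(ℭ(S))`. -/
def completion' : ObjectProperty T :=
  lim' M F ⊓ (compactlySupported M).inverseImage (restrictedYoneda F)

end GoodExtension

end

end MetricCompletion

universe w v u₁ u₂

/-!
Call an object `A` of `T` supported if `𝒴(A)` lies in `ℭ(S)`. Since `𝒴(A)` is a restriction of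
`Hom(-, A)`, this says that for every `j` there are no maps from `F(m⟦j⟧)` to `A` when `m` is in
`M i` and `i` is large (`supported_iff`). Hence, if `E` is a Cauchy sequence and `A` is supported,
the inverse sequence `Hom(F(E n), A)` is eventually constant (`IsCauchy.exists_bijective`): its
`lim¹` vanishes, and `hocolim F(E)` is an honest colimit of `F(E)` as far as maps to supported
objects are concerned (`isSupportedColimit_homotopyColimit`). Moreover these maps are the maps from
`F(E n)` for any single large `n`. All constructions below with cocones are therefore made at one
large index.

Combined with the definition of a good extension, which computes `Hom(F(s), hocolim F(E))` as
`colim Hom(s, E n)`, this shows that `𝒴` is fully faithful on `𝔏'(S) ∩ 𝒴⁻¹(ℭ(S))`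
(`SeqCocone.IsYonedaColimit.bijective_map`). Essential surjectivity onto `𝔖(S)` is immediate from
the definitions, so `𝒴` restricts to an equivalence (`comparison_isEquivalence`).

For closure under cones, a map `hocolim F(E) ⟶ hocolim F(E')` comes from a morphism from `E` to a
subsequence of `E'` (`exists_natTrans`). By the `3 × 3` lemma the cones of its components can be
arranged into a Cauchy sequence (`exists_cauchy_cones`). The cone in `T` of the given map is then
the homotopy colimit of this sequence (`exists_colimit_seqCocone₃`): by the five lemma both
represent the same functor on supported objects, and both are supported.

Thus `𝔏'(S) ∩ 𝒴⁻¹(ℭ(S))` is a triangulated subcategory of `T` whose distinguished triangles are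
colimits of Cauchy sequences of distinguished triangles of `S` (`exists_cauchy_triangles`). The
triangulated structure is transported to `𝔖(S)` along the equivalence. That the transported
triangles are exactly the colimits of Cauchy sequences of triangles is
`essImageDistTriang_comparison`; it uses that `Y ⟶ 𝒴 ∘ F` is compatible with shifts
(`yonedaToRestricted_shift`).
-/

namespace MetricCompletion

noncomputable section

set_option linter.unusedSectionVars false

/-! ### Sequential colimits of additive functors are computed pointwise -/

section

variable {S : Type u₁} [Category.{v} S] [Preadditive S]

instance preservesColimitsOfShape_nat_forget :
    PreservesColimitsOfShape ℕ (forget AddCommGrpCat.{v}) :=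
  have := preservesSmallestFilteredColimits_of_preservesFilteredColimits
    (forget AddCommGrpCat.{v})
  PreservesFilteredColimitsOfSize.preserves_filtered_colimits ℕ

instance reflectsColimitsOfShape_nat_forget :
    ReflectsColimitsOfShape ℕ (forget AddCommGrpCat.{v}) :=
  reflectsColimitsOfShape_of_reflectsIsomorphisms

/-- A sequential colimit, in the category of all functors, of additive functors is additive. -/
lemma additive_colimit (G : ℕ ⥤ ModCat S) :
    (colimit (G ⋙ (additiveFunctor Sᵒᵖ AddCommGrpCat.{v}).ι)).Additive where
  map_add {s t f g} := by
    refine (isColimitOfPreserves ((evaluation _ _).obj s) (colimit.isColimit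
      (G ⋙ (additiveFunctor Sᵒᵖ AddCommGrpCat.{v}).ι))).hom_ext fun n => ?_
    have h (k : s ⟶ t) := (colimit.ι (G ⋙ (additiveFunctor Sᵒᵖ AddCommGrpCat.{v}).ι) n).naturality k
    have : (G.obj n).obj.Additive := (G.obj n).property
    refine (h _).symm.trans ?_
    refine Eq.trans ?_ (Preadditive.comp_add _ _ _ _ _ _).symm
    refine Eq.trans ?_ (congrArg₂ (· + ·) (h f) (h g))
    refine Eq.trans ?_ (Preadditive.add_comp _ _ _ _ _ _)
    congr 1
    exact (G.obj n).obj.map_add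

instance : PreservesColimitsOfShape ℕ (additiveFunctor Sᵒᵖ AddCommGrpCat.{v}).ι where
  preservesColimit {G} := by
    let ι := (additiveFunctor Sᵒᵖ AddCommGrpCat.{v}).ι
    let c : Cocone G :=
      { pt := ⟨colimit (G ⋙ ι), additive_colimit G⟩
        ι := { app n := ObjectProperty.homMk (colimit.ι (G ⋙ ι) n)
               naturality n m f := by
                ext : 1
                exact (colimit.cocone (G ⋙ ι)).ι.naturality f } }
    have hc : IsColimit (ι.mapCocone c) := colimit.isColimit (G ⋙ ι)
    exact preservesColimit_of_preserves_colimit_cocone (isColimitOfReflects ι hc) hc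

/-- A cocone on a sequence of additive functors is a colimit cocone if and only if it is so
on elements. -/
lemma nonempty_isColimit_iff {G : ℕ ⥤ ModCat S} (c : Cocone G) :
    Nonempty (IsColimit c) ↔ ∀ s : Sᵒᵖ,
      (∀ x : c.pt.obj.obj s, ∃ (n : ℕ) (y : (G.obj n).obj.obj s),
        ((c.ι.app n).hom.app s).hom y = x) ∧
      (∀ (n : ℕ) (y : (G.obj n).obj.obj s), ((c.ι.app n).hom.app s).hom y = 0 →
        ∃ (m : ℕ) (h : n ≤ m), ((G.map (homOfLE h)).hom.app s).hom y = 0) := by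
  let ι := (additiveFunctor Sᵒᵖ AddCommGrpCat.{v}).ι
  constructor
  · rintro ⟨hc⟩ s
    have hc' := isColimitOfPreserves (ι ⋙ (evaluation _ _).obj s) hc
    refine ⟨fun x => Concrete.isColimit_exists_rep _ hc' x, fun n y hy => ?_⟩
    obtain ⟨m, f, g, h⟩ := Concrete.isColimit_exists_of_rep_eq _ hc' y (0 : (G.obj n).obj.obj s)
      (hy.trans (map_zero _).symm)
    refine ⟨m, leOfHom f, ?_⟩
    exact h.trans (map_zero _)
  · intro h
    refine ⟨isColimitOfReflects ι (evaluationJointlyReflectsColimits _ fun s =>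
      isColimitOfReflects (forget AddCommGrpCat) (Types.FilteredColimit.isColimitOf' _ _ ?_ ?_))⟩
    · intro x
      obtain ⟨n, y, hy⟩ := (h s).1 x
      exact ⟨n, y, hy.symm⟩
    · intro n (y : (G.obj n).obj.obj s) (z : (G.obj n).obj.obj s) hyz
      obtain ⟨m, hm, e⟩ := (h s).2 n (y - z) (by
        rw [map_sub, sub_eq_zero]
        exact hyz)
      refine ⟨m, homOfLE hm, ?_⟩
      rw [map_sub, sub_eq_zero] at e
      exact e

end

variable {S : Type u₁} [Category.{v} S] [Preadditive S] [HasZeroObject S] [HasShift S ℤ]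
  [∀ n : ℤ, (shiftFunctor S n).Additive] [Pretriangulated S]
  {T : Type u₂} [Category.{v} T] [Preadditive T] [HasZeroObject T] [HasShift T ℤ]
  [∀ n : ℤ, (shiftFunctor T n).Additive] [Pretriangulated T]
  (M : Metric S) (F : S ⥤ T) [F.CommShift ℤ] [F.IsTriangulated]

/-! ### Exactness properties of distinguished triangles -/

section Exactness

variable {X Y Z A : T} {f : X ⟶ Y} {g : Y ⟶ Z} {h : Z ⟶ X⟦(1 : ℤ)⟧}

lemma exists_comp_eq₁ (hT : Triangle.mk f g h ∈ distTriang T) (k : X⟦(1 : ℤ)⟧ ⟶ A)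
    (hk : h ≫ k = 0) : ∃ l : Y⟦(1 : ℤ)⟧ ⟶ A, f⟦(1 : ℤ)⟧' ≫ l = k := by
  obtain ⟨l, hl⟩ := Triangle.yoneda_exact₃ _ (rot_of_distTriang _ hT) k hk
  exact ⟨-l, (Preadditive.comp_neg _ _).trans ((Preadditive.neg_comp _ _).symm.trans hl.symm)⟩

lemma exists_comp_eq₂ (hT : Triangle.mk f g h ∈ distTriang T) (k : Y ⟶ A)
    (hk : f ≫ k = 0) : ∃ l : Z ⟶ A, g ≫ l = k := by
  obtain ⟨l, hl⟩ := Triangle.yoneda_exact₂ _ hT k hk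
  exact ⟨l, hl.symm⟩

lemma exists_comp_eq₃ (hT : Triangle.mk f g h ∈ distTriang T) (k : Z ⟶ A)
    (hk : g ≫ k = 0) : ∃ l : X⟦(1 : ℤ)⟧ ⟶ A, h ≫ l = k := by
  obtain ⟨l, hl⟩ := Triangle.yoneda_exact₃ _ hT k hk
  exact ⟨l, hl.symm⟩

lemma map_distTriang {X Y Z : S} {f : X ⟶ Y} {g : Y ⟶ Z} {h : Z ⟶ X⟦(1 : ℤ)⟧}
    (hT : Triangle.mk f g h ∈ distTriang S) :
    Triangle.mk (F.map f) (F.map g) (F.map h ≫ (F.commShiftIso (1 : ℤ)).hom.app X) ∈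
      distTriang T :=
  F.map_distinguished _ hT

end Exactness

/-! ### Objects of `T` that are compactly supported with respect to the metric -/

/-- The part of the Yoneda lemma needed here: a natural transformation `Y(s) ⟶ A` vanishes as soon
as it kills the identity of `s`. -/
lemma eq_zero_of_app_id {s : S} {A : ModCat S} (φ : (yonedaMod S).obj s ⟶ A)
    (h : (φ.hom.app (Opposite.op s)).hom (𝟙 s) = 0) : φ = 0 := by
  ext t (g : t.unop ⟶ s)
  have := congrArg (fun k => k.hom (𝟙 s)) (φ.hom.naturality g.op)
  change (φ.hom.app t).hom (g ≫ 𝟙 s) =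
    (A.obj.map g.op).hom ((φ.hom.app (Opposite.op s)).hom (𝟙 s)) at this
  rw [Category.comp_id, h, map_zero] at this
  exact this

/-- The objects `A` of `T` such that `𝒴(A)` is compactly supported. -/
abbrev supported : ObjectProperty T :=
  (compactlySupported M).inverseImage (restrictedYoneda F)

variable {M F} in
/-- As `𝒴(A)` is a restriction of `Hom(-, A)`, compact support of `𝒴(A)` is a vanishing of maps
in `T`. -/
lemma supported_iff {A : T} : supported M F A ↔
    ∀ j : ℤ, ∃ i : ℕ, ∀ m : S, M.obj i m → ∀ f : F.obj (m⟦j⟧) ⟶ A, f = 0 := by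
  refine forall_congr' fun j => exists_congr fun i => forall_congr' fun m =>
    imp_congr_right fun _ => ⟨fun h f => ?_, fun h φ => ?_⟩
  · have := congrArg (fun φ => (φ.hom.app (Opposite.op _)).hom (𝟙 _))
      (h ((yonedaToRestricted F).app _ ≫ (restrictedYoneda F).map f))
    change F.map (𝟙 _) ≫ f = 0 at this
    simpa using this
  · exact eq_zero_of_app_id φ (h _)

lemma Metric.antitone : Antitone M.obj := antitone_nat_of_succ_le M.succ_le

instance : (supported M F).IsStableUnderShift ℤ where
  isStableUnderShiftBy n :=
    { le_shift := fun A hA => (compactlySupported M).prop_of_iso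
        (((restrictedYoneda F).commShiftIso n).symm.app A)
        ((compactlySupported M).le_shift n _ hA) }

variable {M F} in
lemma supported_shift {A : T} (hA : supported M F A) (n : ℤ) : supported M F (A⟦n⟧) :=
  (supported M F).le_shift n _ hA

variable {M F} in
lemma supported_of_distTriang (X : Triangle T) (hX : X ∈ distTriang T)
    (h₁ : supported M F X.obj₁) (h₃ : supported M F X.obj₃) : supported M F X.obj₂ := by
  rw [supported_iff] at h₁ h₃ ⊢
  intro j
  obtain ⟨i, hi⟩ := h₁ j
  obtain ⟨i', hi'⟩ := h₃ j
  refine ⟨max i i', fun m hm f => ?_⟩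
  obtain ⟨g, rfl⟩ := Triangle.coyoneda_exact₂ X hX f
    (hi' m (M.antitone (le_max_right i i') _ hm) _)
  rw [hi m (M.antitone (le_max_left i i') _ hm) g, zero_comp]

variable {M F} in
lemma supported_cone (X : Triangle T) (hX : X ∈ distTriang T)
    (h₁ : supported M F X.obj₁) (h₂ : supported M F X.obj₂) : supported M F X.obj₃ :=
  supported_of_distTriang _ (rot_of_distTriang _ hX) h₂ (supported_shift h₁ 1)

/-! ### Cauchy sequences are eventually constant for supported objects -/

/-- In an inverse sequence of abelian groups with eventually surjective transition maps, the
equations `k n - u (k (n + 1)) = h n` have a solution with prescribed `N`-th term. -/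
lemma exists_solution {H : ℕ → Type*} [∀ n, AddCommGroup (H n)] (u : ∀ n, H (n + 1) →+ H n)
    (N : ℕ) (hu : ∀ n, N ≤ n → Function.Surjective (u n)) (h : ∀ n, H n) (g : H N) :
    ∃ k : ∀ n, H n, k N = g ∧ ∀ n, k n - u n (k (n + 1)) = h n := by
  induction N generalizing H with
  | zero =>
    -- all maps are surjective: lift successively, starting from `g`
    choose σ hσ using fun n => hu n (Nat.zero_le n)
    refine ⟨fun n => Nat.rec g (fun n k => σ n (k - h n)) n, rfl, fun n => ?_⟩
    simp [hσ]
  | succ N ih =>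
    -- the equation of index `0` determines the term of index `0` from the others
    obtain ⟨k, hk, hk'⟩ := ih (H := fun n => H (n + 1)) (fun n => u (n + 1))
      (fun n hn => hu _ (by lia)) (fun n => h (n + 1)) g
    refine ⟨fun n => match n with
      | 0 => h 0 + u 0 (k 0)
      | n + 1 => k n, hk, fun n => ?_⟩
    cases n with
    | zero => simp
    | succ n => exact hk' n

variable {M F}

/-- If `E` is Cauchy and `A` is supported, the inverse sequence `Hom(F(E n), A)` is eventually
constant. -/
lemma IsCauchy.exists_bijective {E : ℕ ⥤ S} (hE : IsCauchy M E) {A : T} (hA : supported M F A) :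
    ∃ N : ℕ, ∀ (m m' : ℕ) (_ : N ≤ m) (h : m ≤ m'),
      Function.Bijective (fun g : F.obj (E.obj m') ⟶ A => F.map (E.map (homOfLE h)) ≫ g) := by
  rw [supported_iff] at hA
  -- for large indices there are no maps to `A` from `F(D)` and `F(D⟦-1⟧)`, where `D` is the cone of
  -- `E m ⟶ E m'`: this gives injectivity and surjectivity, respectively
  obtain ⟨i, hi⟩ := hA 0
  obtain ⟨i', hi'⟩ := hA (-1)
  obtain ⟨N, hN⟩ := hE i 0
  obtain ⟨N', hN'⟩ := hE i' 0
  have hi0 := M.isClosedUnderIsomorphisms i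
  have hi0' := M.isClosedUnderIsomorphisms i'
  refine ⟨max N N', fun m m' hm h => ?_⟩
  obtain rfl | h' := h.eq_or_lt
  · have h₀ : F.map (E.map (homOfLE h)) = 𝟙 _ := by simp
    simp only [h₀, Category.id_comp]
    exact Function.bijective_id
  obtain ⟨D, g, δ, hD⟩ := distinguished_cocone_triangle (E.map (homOfLE h))
  have hD₁ : M.obj i D := (M.obj i).prop_of_iso ((shiftFunctorZero S ℤ).app D)
    (hN m m' ((le_max_left _ _).trans hm) h' D g δ hD)
  have hD₂ : M.obj i' D := (M.obj i').prop_of_iso ((shiftFunctorZero S ℤ).app D)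
    (hN' m m' ((le_max_right _ _).trans hm) h' D g δ hD)
  have h₁ (f : F.obj D ⟶ A) : f = 0 := by
    rw [← cancel_epi (F.map ((shiftFunctorZero S ℤ).hom.app D)), hi D hD₁ (F.map _ ≫ f), comp_zero]
  constructor
  · intro f f' hf
    rw [← sub_eq_zero] at hf ⊢
    obtain ⟨k, hk⟩ := exists_comp_eq₂ (map_distTriang F hD) (f - f')
      (by simpa [Preadditive.comp_sub] using hf)
    rw [← hk, h₁ k, comp_zero]
  · intro f
    have h₂ := inv_rot_of_distTriang _ (F.map_distinguished _ hD)
    obtain ⟨k, hk⟩ := exists_comp_eq₂ h₂ f ((cancel_epi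
      ((F.commShiftIso (-1 : ℤ)).hom.app D)).1 ((hi' D hD₂ _).trans comp_zero.symm))
    exact ⟨k, hk⟩

/-- A cocone with point `X` on the sequence `F(E 0) ⟶ F(E 1) ⟶ ⋯`. -/
@[ext]
structure SeqCocone (F : S ⥤ T) (E : ℕ ⥤ S) (X : T) where
  /-- the components of the cocone -/
  app (n : ℕ) : F.obj (E.obj n) ⟶ X
  w {n m : ℕ} (h : n ≤ m) : F.map (E.map (homOfLE h)) ≫ app m = app n

namespace SeqCocone

variable {E : ℕ ⥤ S} {X X' A : T}

lemma w_assoc (α : SeqCocone F E X) {n m : ℕ} (h : n ≤ m) (g : X ⟶ A) :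
    F.map (E.map (homOfLE h)) ≫ α.app m ≫ g = α.app n ≫ g := by
  rw [← Category.assoc, α.w]

/-- A cocone from its compatibility with consecutive maps of the sequence. -/
def ofSucc (app : ∀ n, F.obj (E.obj n) ⟶ X)
    (w : ∀ n, F.map (E.map (homOfLE n.le_succ)) ≫ app (n + 1) = app n) : SeqCocone F E X where
  app := app
  w {n m} h := by
    induction m, h using Nat.le_induction with
    | base => simp
    | succ m h ih =>
      rw [← homOfLE_comp h m.le_succ, Functor.map_comp, Functor.map_comp, Category.assoc, w, ih]

/-- The composition of a cocone with a map from its point. -/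
@[simps]
def comp (α : SeqCocone F E X) (g : X ⟶ A) : SeqCocone F E A where
  app n := α.app n ≫ g
  w h := by rw [α.w_assoc]

end SeqCocone

/-- If `E` is Cauchy and `A` is supported, a cocone on `F(E)` with point `A` is determined by,
and can be extended from, any one of its components of sufficiently high index. -/
lemma IsCauchy.exists_bijective_app {E : ℕ ⥤ S} (hE : IsCauchy M E) {A : T}
    (hA : supported M F A) :
    ∃ N : ℕ, ∀ n, N ≤ n → Function.Bijective (fun γ : SeqCocone F E A => γ.app n) := by
  obtain ⟨N, hN⟩ := hE.exists_bijective hA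
  refine ⟨N, fun n hn => ⟨fun γ γ' hγ => ?_, fun g => ?_⟩⟩
  · have key (m : ℕ) (hm : n ≤ m) : γ.app m = γ'.app m :=
      (hN n m hn hm).1 (by simpa [SeqCocone.w] using hγ)
    ext m
    rw [← γ.w (le_max_right n m), ← γ'.w (le_max_right n m), key _ (le_max_left n m)]
  · obtain ⟨k, hk, hk'⟩ := exists_solution (H := fun n => F.obj (E.obj n) ⟶ A)
      (fun m => (preadditiveYoneda.obj A).map (F.map (E.map (homOfLE m.le_succ))).op |>.hom) n
      (fun m hm => (hN m (m + 1) (hn.trans hm) m.le_succ).2) 0 g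
    refine ⟨SeqCocone.ofSucc k (fun m => ?_), hk⟩
    have : k m - F.map (E.map (homOfLE m.le_succ)) ≫ k (m + 1) = 0 := hk' m
    exact (sub_eq_zero.1 this).symm

/-! ### Homotopy colimits of Cauchy sequences are colimits for maps into supported objects -/

variable (M) in
/-- The cocone `α` on `F(E)` with point `X` is a colimit cocone as far as maps from `X` to
supported objects are concerned. -/
def IsSupportedColimit {E : ℕ ⥤ S} {X : T} (α : SeqCocone F E X) : Prop :=
  ∀ A : T, supported M F A → Function.Bijective (fun g : X ⟶ A => α.comp g)

namespace IsSupportedColimit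

variable {E : ℕ ⥤ S} {X X' A : T} {α : SeqCocone F E X} {α' : SeqCocone F E X'}

lemma hom_ext (hα : IsSupportedColimit M α) (hA : supported M F A) {f g : X ⟶ A}
    (h : ∀ n, α.app n ≫ f = α.app n ≫ g) : f = g :=
  (hα A hA).1 (by ext n; exact h n)

lemma exists_desc (hα : IsSupportedColimit M α) (hA : supported M F A) (γ : SeqCocone F E A) :
    ∃ g : X ⟶ A, ∀ n, α.app n ≫ g = γ.app n := by
  obtain ⟨g, hg⟩ := (hα A hA).2 γ
  exact ⟨g, fun n => congrArg (fun γ => γ.app n) hg⟩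

/-- The maps from `X` to a supported object `A` are those from `F(E n)` to `A`, for `n` large. -/
lemma exists_bijective (hα : IsSupportedColimit M α) (hE : IsCauchy M E)
    (hA : supported M F A) :
    ∃ N : ℕ, ∀ n, N ≤ n → Function.Bijective (fun g : X ⟶ A => α.app n ≫ g) := by
  obtain ⟨N, hN⟩ := hE.exists_bijective_app hA
  exact ⟨N, fun n hn => (hN n hn).comp (hα A hA)⟩

/-- The converse of `exists_bijective`. It allows checking `IsSupportedColimit` at one index at a
time, so that no coproduct or homotopy colimit enters. -/
lemma of_exists_bijective (hE : IsCauchy M E) (hα : ∀ A : T, supported M F A →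
      ∃ N : ℕ, ∀ n, N ≤ n → Function.Bijective (fun g : X ⟶ A => α.app n ≫ g)) :
    IsSupportedColimit M α := by
  intro A hA
  obtain ⟨N, hN⟩ := hE.exists_bijective_app hA
  obtain ⟨N', hN'⟩ := hα A hA
  exact (Function.Bijective.of_comp_iff' (hN (max N N') (le_max_left _ _)) _).1
    (hN' (max N N') (le_max_right _ _))

/-- Two supported objects that are both colimits of the same sequence for maps to supported
objects are isomorphic. -/
lemma exists_iso (hα : IsSupportedColimit M α) (hα' : IsSupportedColimit M α')
    (hX : supported M F X) (hX' : supported M F X') :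
    ∃ e : X ≅ X', ∀ n, α.app n ≫ e.hom = α'.app n := by
  obtain ⟨f, hf⟩ := hα.exists_desc hX' α'
  obtain ⟨g, hg⟩ := hα'.exists_desc hX α
  refine ⟨⟨f, g, hα.hom_ext hX fun n => ?_, hα'.hom_ext hX' fun n => ?_⟩, hf⟩
  · rw [reassoc_of% hf, hg, Category.comp_id]
  · rw [reassoc_of% hg, hf, Category.comp_id]

end IsSupportedColimit

/-- The equation `(1 - shift) ≫ k = f` in `k` is solvable for maps to a supported object: this is
the vanishing of `lim¹`. -/
lemma IsCauchy.exists_one_sub_shiftMap_comp {E : ℕ ⥤ S} (hE : IsCauchy M E)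
    {c : Cofan (E ⋙ F).obj} (hc : IsColimit c) {A : T} (hA : supported M F A) (f : c.pt ⟶ A) :
    ∃ k : c.pt ⟶ A, (𝟙 c.pt - shiftMap hc) ≫ k = f := by
  obtain ⟨N, hN⟩ := hE.exists_bijective hA
  obtain ⟨k, -, hk⟩ := exists_solution (H := fun n => F.obj (E.obj n) ⟶ A)
    (fun m => (preadditiveYoneda.obj A).map (F.map (E.map (homOfLE m.le_succ))).op |>.hom) N
    (fun m hm => (hN m (m + 1) hm m.le_succ).2) (fun n => c.inj n ≫ f) 0
  refine ⟨Cofan.IsColimit.desc hc k, Cofan.IsColimit.hom_ext hc _ _ fun n => ?_⟩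
  have : k n - F.map (E.map (homOfLE n.le_succ)) ≫ k (n + 1) = c.inj n ≫ f := hk n
  rw [← this, Preadditive.sub_comp, Preadditive.comp_sub, Category.id_comp, shiftMap,
    Cofan.IsColimit.fac, Cofan.IsColimit.fac_assoc, Category.assoc, Cofan.IsColimit.fac]
  rfl

/-- The canonical maps `F(E n) ⟶ hocolim F(E)`. -/
def HomotopyColimit.seqCocone {E : ℕ ⥤ S} (h : HomotopyColimit (E ⋙ F)) :
    SeqCocone F E h.pt where
  app n := h.cocone.ι.app n
  w i := h.cocone.w (homOfLE i)

lemma HomotopyColimit.seqCocone_app {E : ℕ ⥤ S} (h : HomotopyColimit (E ⋙ F)) (n : ℕ) :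
    h.seqCocone.app n = h.cofan.inj n ≫ h.π := rfl

/-- Homotopy colimits only have the weak universal property in general. For a Cauchy sequence and a
supported target the lift is unique, since two lifts differ by an element of a `lim¹` that
vanishes. -/
lemma isSupportedColimit_homotopyColimit {E : ℕ ⥤ S} (hE : IsCauchy M E)
    (h : HomotopyColimit (E ⋙ F)) : IsSupportedColimit M h.seqCocone := by
  intro A hA
  constructor
  · intro f f' hff'
    have hπ : h.π ≫ (f - f') = 0 := by
      refine Cofan.IsColimit.hom_ext h.isColimit _ _ fun n => ?_
      have := congrArg (fun γ => γ.app n) hff'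
      simp only [SeqCocone.comp_app, h.seqCocone_app] at this
      rw [comp_zero, Preadditive.comp_sub, Preadditive.comp_sub, sub_eq_zero]
      simpa using this
    -- the difference factors through `δ`, and its factor is divisible by `1 - shift`
    obtain ⟨k, hk⟩ := exists_comp_eq₃ h.distinguished (f - f') hπ
    let e : (A⟦(-1 : ℤ)⟧)⟦(1 : ℤ)⟧ ≅ A := (shiftEquiv T (1 : ℤ)).counitIso.app A
    obtain ⟨k', hk'⟩ := (shiftFunctor T (1 : ℤ)).map_surjective (k ≫ e.inv)
    obtain ⟨l, rfl⟩ := hE.exists_one_sub_shiftMap_comp h.isColimit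
      (supported_shift hA (-1)) k'
    have h₀ : h.δ ≫ (𝟙 _ - shiftMap h.isColimit)⟦(1 : ℤ)⟧' = 0 :=
      comp_distTriang_mor_zero₃₁ _ h.distinguished
    rw [← sub_eq_zero, ← hk, ← cancel_mono e.inv, Category.assoc, ← hk', Functor.map_comp,
      reassoc_of% h₀, zero_comp, zero_comp]
  · intro γ
    obtain ⟨g, hg⟩ := exists_comp_eq₂ h.distinguished
      (Cofan.IsColimit.desc h.isColimit fun n => γ.app n) (by
        refine Cofan.IsColimit.hom_ext h.isColimit _ _ fun n => ?_
        rw [comp_zero, Preadditive.sub_comp, Preadditive.comp_sub, Category.id_comp, shiftMap,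
          Cofan.IsColimit.fac, Cofan.IsColimit.fac_assoc, Category.assoc, Cofan.IsColimit.fac,
          sub_eq_zero]
        exact (γ.w n.le_succ).symm)
    refine ⟨g, ?_⟩
    ext n
    rw [SeqCocone.comp_app, h.seqCocone_app, Category.assoc, hg, Cofan.IsColimit.fac]

/-! ### Sequences whose colimit is computed in `Mod S` -/

section

variable {E : ℕ ⥤ S} {X X' : T}

/-- The cocone `Y(E n) ⟶ 𝒴(F(E n)) ⟶ 𝒴(X)` induced by a cocone on `F(E)` with point `X`. -/
@[simps]
def SeqCocone.yonedaCocone (α : SeqCocone F E X) : Cocone (E ⋙ yonedaMod S) where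
  pt := (restrictedYoneda F).obj X
  ι :=
    { app n := (yonedaToRestricted F).app (E.obj n) ≫ (restrictedYoneda F).map (α.app n)
      naturality n m f := by
        dsimp
        have : F.map (E.map f) ≫ α.app m = α.app n := α.w (leOfHom f)
        rw [Category.comp_id, ← this, Functor.map_comp, ← Category.assoc, ← Category.assoc]
        congr 1
        exact (yonedaToRestricted F).naturality _ }

/-- The property of a cocone on `F(E)` with point `X` that it induces a bijection
`colim Hom(s, E n) ⟶ Hom(F(s), X)` for all objects `s` of `S`. -/
def SeqCocone.IsYonedaColimit (α : SeqCocone F E X) : Prop :=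
  ∀ s : S, (∀ x : F.obj s ⟶ X, ∃ (n : ℕ) (f : s ⟶ E.obj n), F.map f ≫ α.app n = x) ∧
    (∀ (n : ℕ) (f : s ⟶ E.obj n), F.map f ≫ α.app n = 0 →
      ∃ (m : ℕ) (h : n ≤ m), f ≫ E.map (homOfLE h) = 0)

lemma SeqCocone.nonempty_isColimit_yonedaCocone_iff (α : SeqCocone F E X) :
    Nonempty (IsColimit α.yonedaCocone) ↔ α.IsYonedaColimit :=
  (nonempty_isColimit_iff _).trans Opposite.op_surjective.forall

/-- The defining property of good extensions, in terms of elements. -/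
lemma IsGoodExtension.isYonedaColimit (hF : IsGoodExtension M F) (hE : IsCauchy M E)
    (h : HomotopyColimit (E ⋙ F)) : h.seqCocone.IsYonedaColimit :=
  fun s => (nonempty_isColimit_iff _).1 (hF.isColimit E hE h) (Opposite.op s)

namespace SeqCocone.IsYonedaColimit

lemma of_iso {α : SeqCocone F E X} (hα : α.IsYonedaColimit) {α' : SeqCocone F E X'} (e : X ≅ X')
    (he : ∀ n, α.app n ≫ e.hom = α'.app n) : α'.IsYonedaColimit := by
  refine fun s => ⟨fun x => ?_, fun n f hf => (hα s).2 n f ?_⟩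
  · obtain ⟨n, f, hf⟩ := (hα s).1 (x ≫ e.inv)
    exact ⟨n, f, by rw [← he, reassoc_of% hf, e.inv_hom_id, Category.comp_id]⟩
  · rw [← he, ← Category.assoc] at hf
    rwa [← cancel_mono e.hom, zero_comp]

/-- The vanishing of `Hom(F(s), X)` is a condition on the sequence `E` alone. -/
lemma forall_eq_zero_iff {α : SeqCocone F E X} (hα : α.IsYonedaColimit) (s : S) :
    (∀ x : F.obj s ⟶ X, x = 0) ↔
      ∀ (n : ℕ) (f : s ⟶ E.obj n), ∃ (m : ℕ) (h : n ≤ m), f ≫ E.map (homOfLE h) = 0 := by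
  refine ⟨fun h n f => (hα s).2 n f (h _), fun h x => ?_⟩
  obtain ⟨n, f, rfl⟩ := (hα s).1 x
  obtain ⟨m, hm, hf⟩ := h n f
  rw [← α.w hm, ← Category.assoc, ← F.map_comp, hf, F.map_zero, zero_comp]

lemma supported_iff {α : SeqCocone F E X} (hα : α.IsYonedaColimit)
    {α' : SeqCocone F E X'} (hα' : α'.IsYonedaColimit) :
    supported M F X ↔ supported M F X' := by
  simp only [MetricCompletion.supported_iff, hα.forall_eq_zero_iff, hα'.forall_eq_zero_iff]

/-- Two maps from an object of `S` to a term of the sequence that agree in the colimit agree at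
a later stage. -/
lemma exists_comp_eq {α : SeqCocone F E X} (hα : α.IsYonedaColimit) {s : S} {n m : ℕ}
    (f : s ⟶ E.obj n) (g : s ⟶ E.obj m) (h : F.map f ≫ α.app n = F.map g ≫ α.app m) :
    ∃ (p : ℕ) (hn : n ≤ p) (hm : m ≤ p),
      f ≫ E.map (homOfLE hn) = g ≫ E.map (homOfLE hm) := by
  obtain ⟨p, hp, e⟩ := (hα s).2 (max n m) (f ≫ E.map (homOfLE (le_max_left n m)) -
    g ≫ E.map (homOfLE (le_max_right n m))) (by
      simp only [Functor.map_sub, Functor.map_comp, Preadditive.sub_comp, Category.assoc, α.w]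
      rw [h, sub_self])
  refine ⟨p, (le_max_left n m).trans hp, (le_max_right n m).trans hp, ?_⟩
  rw [Preadditive.sub_comp, sub_eq_zero, Category.assoc, Category.assoc, ← E.map_comp,
    ← E.map_comp] at e
  exact e

end SeqCocone.IsYonedaColimit

lemma IsSupportedColimit.of_iso {α : SeqCocone F E X} (hα : IsSupportedColimit M α)
    {α' : SeqCocone F E X'} (e : X ≅ X') (he : ∀ n, α.app n ≫ e.hom = α'.app n) :
    IsSupportedColimit M α' := by
  intro A hA
  convert (hα A hA).comp (e.homFromEquiv (Z := A)).symm.bijective using 1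
  ext g n
  simp [← he]

end

/-! ### Shifts of cocones -/

section

variable {E : ℕ ⥤ S} {X : T}

/-- The shift of a cocone. -/
@[simps]
def SeqCocone.shift (α : SeqCocone F E X) (n : ℤ) :
    SeqCocone F (E ⋙ shiftFunctor S n) (X⟦n⟧) where
  app k := (F.commShiftIso n).hom.app (E.obj k) ≫ (α.app k)⟦n⟧'
  w {k l} h := by
    have := (F.commShiftIso n).hom.naturality (E.map (homOfLE h))
    dsimp at this ⊢
    rw [reassoc_of% this, ← Functor.map_comp, α.w]

lemma bijective_shift_comp {X Y A : T} (u : X ⟶ Y) (n : ℤ)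
    (h : Function.Bijective (fun g : Y ⟶ A⟦-n⟧ => u ≫ g)) :
    Function.Bijective (fun g : Y⟦n⟧ ⟶ A => u⟦n⟧' ≫ g) := by
  let e : (A⟦-n⟧)⟦n⟧ ≅ A := (shiftFunctorCompIsoId T (-n) n (by simp)).app A
  constructor
  · intro g g' hg
    obtain ⟨k, hk⟩ := (shiftFunctor T n).map_surjective (g ≫ e.inv)
    obtain ⟨k', hk'⟩ := (shiftFunctor T n).map_surjective (g' ≫ e.inv)
    rw [← cancel_mono e.inv, ← hk, ← hk']
    refine congrArg _ (h.1 ((shiftFunctor T n).map_injective ?_))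
    dsimp at hg ⊢
    rw [Functor.map_comp, Functor.map_comp, hk, hk', reassoc_of% hg]
  · intro g
    obtain ⟨k, hk⟩ := (shiftFunctor T n).map_surjective (g ≫ e.inv)
    obtain ⟨l, hl⟩ := h.2 k
    dsimp at hl
    refine ⟨l⟦n⟧' ≫ e.hom, ?_⟩
    dsimp only
    rw [← Functor.map_comp_assoc, hl, hk, Category.assoc, e.inv_hom_id, Category.comp_id]

lemma IsSupportedColimit.exists_bijective_shift (hE : IsCauchy M E)
    {α : SeqCocone F E X} (hα : IsSupportedColimit M α) (n : ℤ) {A : T} (hA : supported M F A) :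
    ∃ N : ℕ, ∀ k, N ≤ k → Function.Bijective (fun g : X⟦n⟧ ⟶ A => (α.app k)⟦n⟧' ≫ g) := by
  obtain ⟨N, hN⟩ := hα.exists_bijective hE (supported_shift hA (-n))
  exact ⟨N, fun k hk => bijective_shift_comp _ _ (hN k hk)⟩

lemma IsSupportedColimit.shift (hE : IsCauchy M E) {α : SeqCocone F E X}
    (hα : IsSupportedColimit M α) (n : ℤ) : IsSupportedColimit M (α.shift n) := by
  refine .of_exists_bijective (hE.shift M n) fun A hA => ?_
  obtain ⟨N, hN⟩ := hα.exists_bijective_shift hE n hA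
  refine ⟨N, fun k hk => ?_⟩
  have h := (((F.commShiftIso n).app (E.obj k)).homFromEquiv (Z := A)).symm.bijective.comp
    (hN k hk)
  refine (congrArg Function.Bijective (funext fun g => ?_)).mpr h
  exact Category.assoc _ _ _

lemma SeqCocone.IsYonedaColimit.shift (hF : IsGoodExtension M F) {α : SeqCocone F E X}
    (hα : α.IsYonedaColimit) (n : ℤ) : (α.shift n).IsYonedaColimit := by
  have := hF.faithful
  intro s
  let e : (s⟦-n⟧)⟦n⟧ ≅ s := (shiftFunctorCompIsoId S (-n) n (by simp)).app s
  let e' := (F.commShiftIso n).app (s⟦-n⟧)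
  have key (k : ℕ) (f : s⟦-n⟧ ⟶ E.obj k) :
      F.map (f⟦n⟧') ≫ (α.shift n).app k = e'.hom ≫ (F.map f ≫ α.app k)⟦n⟧' := by
    have := (F.commShiftIso n).hom.naturality f
    dsimp at this ⊢
    rw [Functor.map_comp]
    exact (reassoc_of% this) _
  constructor
  · intro x
    obtain ⟨y, hy⟩ := (shiftFunctor T n).map_surjective (e'.inv ≫ F.map e.hom ≫ x)
    obtain ⟨k, f, rfl⟩ := (hα _).1 y
    refine ⟨k, e.inv ≫ f⟦n⟧', ?_⟩
    rw [F.map_comp, Category.assoc, key, hy, e'.hom_inv_id_assoc, ← F.map_comp_assoc,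
      e.inv_hom_id, F.map_id, Category.id_comp]
  · intro k f hf
    obtain ⟨g, hg⟩ := (shiftFunctor S n).map_surjective (e.hom ≫ f)
    obtain ⟨m, h, hm⟩ := (hα _).2 k g ((shiftFunctor T n).map_injective (by
      rw [← cancel_epi e'.hom, ← key, hg, F.map_comp, Category.assoc, hf, Functor.map_zero,
        comp_zero, comp_zero]))
    refine ⟨m, h, ?_⟩
    rw [← cancel_epi e.hom, ← Category.assoc, ← hg, comp_zero]
    exact ((shiftFunctor S n).map_comp _ _).symm.trans (by rw [hm, Functor.map_zero])

end

/-! ### Homotopy colimits and the subcategory `𝔏'(S) ∩ 𝒴⁻¹(ℭ(S))` -/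

section

variable {E : ℕ ⥤ S} {X : T}

/-- Coproducts indexed by a universe `w` provide countable ones, hence homotopy colimits. -/
lemma nonempty_homotopyColimit [HasCoproducts.{w} T] (X : ℕ ⥤ T) :
    Nonempty (HomotopyColimit X) := by
  have : HasCoproducts.{0} T := hasCoproducts_shrink.{0, w}
  obtain ⟨Z, π, δ, h⟩ := distinguished_cocone_triangle
    (𝟙 _ - shiftMap (coproductIsCoproduct X.obj))
  exact ⟨⟨_, coproductIsCoproduct X.obj, Z, π, δ, h⟩⟩

lemma completion'.exists_seqCocone (hF : IsGoodExtension M F) (hX : completion' M F X) :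
    ∃ E : ℕ ⥤ S, IsCauchy M E ∧ ∃ α : SeqCocone F E X,
      IsSupportedColimit M α ∧ α.IsYonedaColimit := by
  obtain ⟨⟨E, hE, h, ⟨e⟩⟩, -⟩ := hX
  exact ⟨E, hE, h.seqCocone.comp e.inv,
    (isSupportedColimit_homotopyColimit hE h).of_iso e.symm fun _ => rfl,
    (hF.isYonedaColimit hE h).of_iso e.symm fun _ => rfl⟩

/-- A supported object `X` that is the colimit of a Cauchy sequence for maps to supported objects
is the homotopy colimit of this sequence, as soon as the latter is supported as well. -/
lemma IsSupportedColimit.completion' (hF : IsGoodExtension M F) (hE : IsCauchy M E)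
    {α : SeqCocone F E X} (hα : IsSupportedColimit M α) (hX : supported M F X)
    (h : HomotopyColimit (E ⋙ F)) (hh : supported M F h.pt) :
    completion' M F X ∧ α.IsYonedaColimit := by
  obtain ⟨e, he⟩ := (isSupportedColimit_homotopyColimit hE h).exists_iso hα hh hX
  exact ⟨⟨⟨E, hE, h, ⟨e.symm⟩⟩, hX⟩, (hF.isYonedaColimit hE h).of_iso e he⟩

lemma completion'_shift [HasCoproducts.{w} T] (hF : IsGoodExtension M F)
    (hX : completion' M F X) (n : ℤ) : completion' M F (X⟦n⟧) := by
  obtain ⟨E, hE, α, hα, hα'⟩ := hX.exists_seqCocone hF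
  have hX' := supported_shift hX.2 n
  obtain ⟨h⟩ := nonempty_homotopyColimit.{w} ((E ⋙ shiftFunctor S n) ⋙ F)
  exact ((hα.shift hE n).completion' hF (hE.shift M n) hX' h
    (((hα'.shift hF n).supported_iff (hF.isYonedaColimit (hE.shift M n) h)).1 hX')).1

/-- `𝒴` is fully faithful on `𝔏'(S) ∩ 𝒴⁻¹(ℭ(S))`: a natural transformation `𝒴(X) ⟶ 𝒴(A)` is
determined by the images of the components of the cocone `α`, which form a cocone with point `A`. -/
lemma SeqCocone.IsYonedaColimit.bijective_map {α : SeqCocone F E X}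
    (hα : IsSupportedColimit M α) (hα' : α.IsYonedaColimit) {A : T} (hA : supported M F A) :
    Function.Bijective (fun g : X ⟶ A => (restrictedYoneda F).map g) := by
  constructor
  · intro g g' h
    refine hα.hom_ext hA fun n => ?_
    have := congrArg (fun φ => (φ.hom.app (Opposite.op (E.obj n))).hom (α.app n)) h
    exact this
  · intro θ
    have nat {s t : S} (f : s ⟶ t) (x : F.obj t ⟶ X) :
        (θ.hom.app (Opposite.op s)).hom (F.map f ≫ x) =
          F.map f ≫ (show F.obj t ⟶ A from (θ.hom.app (Opposite.op t)).hom x) :=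
      congrArg (fun k => k.hom x) (θ.hom.naturality f.op)
    obtain ⟨g, hg⟩ := hα.exists_desc hA
      { app n := (θ.hom.app (Opposite.op (E.obj n))).hom (α.app n)
        w h := by
          rw [← α.w h]
          exact (nat _ _).symm }
    refine ⟨g, ?_⟩
    ext s (x : F.obj s.unop ⟶ X)
    obtain ⟨n, f, rfl⟩ := (hα' _).1 x
    change (F.map f ≫ α.app n) ≫ g = (θ.hom.app (Opposite.op s.unop)).hom (F.map f ≫ α.app n)
    rw [nat, Category.assoc, hg]

end

/-! ### Cones of maps between homotopy colimits -/

/-- The five lemma for the groups of maps from two distinguished triangles to an object `A`. -/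
lemma bijective_comp₃ {X Y Z X' Y' Z' A : T} {f : X ⟶ Y} {g : Y ⟶ Z} {h : Z ⟶ X⟦(1 : ℤ)⟧}
    {f' : X' ⟶ Y'} {g' : Y' ⟶ Z'} {h' : Z' ⟶ X'⟦(1 : ℤ)⟧}
    (hT : Triangle.mk f g h ∈ distTriang T) (hT' : Triangle.mk f' g' h' ∈ distTriang T)
    {u : X ⟶ X'} {v : Y ⟶ Y'} {w : Z ⟶ Z'} (comm₁ : f ≫ v = u ≫ f') (comm₂ : g ≫ w = v ≫ g')
    (comm₃ : h ≫ u⟦(1 : ℤ)⟧' = w ≫ h')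
    (hu : Function.Bijective (fun k : X' ⟶ A => u ≫ k))
    (hv : Function.Bijective (fun k : Y' ⟶ A => v ≫ k))
    (hu₁ : Function.Bijective (fun k : X'⟦(1 : ℤ)⟧ ⟶ A => u⟦(1 : ℤ)⟧' ≫ k))
    (hv₁ : Function.Bijective (fun k : Y'⟦(1 : ℤ)⟧ ⟶ A => v⟦(1 : ℤ)⟧' ≫ k)) :
    Function.Bijective (fun k : Z' ⟶ A => w ≫ k) := by
  have zero₁₂ : f ≫ g = 0 := comp_distTriang_mor_zero₁₂ _ hT
  have zero₃₁ : h' ≫ f'⟦(1 : ℤ)⟧' = 0 := comp_distTriang_mor_zero₃₁ _ hT'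
  have inj (k : Z' ⟶ A) (hk : w ≫ k = 0) : k = 0 := by
    obtain ⟨l, rfl⟩ := exists_comp_eq₃ hT' k (hv.1 (by
      dsimp only
      rw [← reassoc_of% comm₂, hk, comp_zero, comp_zero]))
    obtain ⟨m, hm⟩ := exists_comp_eq₁ hT (u⟦(1 : ℤ)⟧' ≫ l) (by rw [reassoc_of% comm₃, hk])
    obtain ⟨m, rfl⟩ := hv₁.2 m
    have : l = f'⟦(1 : ℤ)⟧' ≫ m := hu₁.1 (by
      dsimp only at hm ⊢
      rw [← hm, ← Functor.map_comp_assoc, ← Functor.map_comp_assoc, comm₁])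
    rw [this, reassoc_of% zero₃₁, zero_comp]
  constructor
  · intro k k' hk
    rw [← sub_eq_zero]
    exact inj _ (by rw [Preadditive.comp_sub, sub_eq_zero]; exact hk)
  · intro k
    obtain ⟨b, hb⟩ := hv.2 (g ≫ k)
    dsimp only at hb
    obtain ⟨c, rfl⟩ := exists_comp_eq₂ hT' b (hu.1 (by
      dsimp only
      rw [← reassoc_of% comm₁, hb, reassoc_of% zero₁₂, zero_comp, comp_zero]))
    obtain ⟨l, hl⟩ := exists_comp_eq₃ hT (k - w ≫ c) (by
      rw [Preadditive.comp_sub, reassoc_of% comm₂, hb, sub_self])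
    obtain ⟨l, rfl⟩ := hu₁.2 l
    dsimp only at hl
    refine ⟨c + h' ≫ l, ?_⟩
    dsimp only
    rw [Preadditive.comp_add, ← reassoc_of% comm₃, hl, add_sub_cancel]

section

variable {K : ℕ ⥤ Triangle S} {A B C : T} {f : A ⟶ B} {g : B ⟶ C} {δ : C ⟶ A⟦(1 : ℤ)⟧}

lemma SeqCocone.hom_ext_of_bijective {E : ℕ ⥤ S} {N : ℕ}
    (hN : Function.Bijective (fun γ : SeqCocone F E A => γ.app N)) {γ γ' : SeqCocone F E A}
    (h : γ.app N = γ'.app N) (n : ℕ) : γ.app n = γ'.app n :=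
  congrArg (fun γ => γ.app n) (hN.1 h)

/-- The restriction of a cocone along a morphism of sequences. -/
def SeqCocone.precomp {E E' : ℕ ⥤ S} (α : SeqCocone F E' A) (φ : E ⟶ E') : SeqCocone F E A where
  app n := F.map (φ.app n) ≫ α.app n
  w {n m} h := by
    rw [← F.map_comp_assoc, φ.naturality, F.map_comp_assoc, α.w]

/-- A cocone on the first two terms of a Cauchy sequence of distinguished triangles, with points
the source and target of a map of supported objects, extends to a cocone of triangles: a
completion to a morphism of triangles is chosen at one sufficiently large index, and the other
components, as well as their compatibilities, are determined by it. -/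
lemma exists_seqCocone₃ (hK : ∀ n, K.obj n ∈ distTriang S)
    (h₂ : IsCauchy M (K ⋙ Triangle.π₂)) (h₃ : IsCauchy M (K ⋙ Triangle.π₃))
    (hT : Triangle.mk f g δ ∈ distTriang T) (hA : supported M F A) (hB : supported M F B)
    (α : SeqCocone F (K ⋙ Triangle.π₁) A) (β : SeqCocone F (K ⋙ Triangle.π₂) B)
    (comm : ∀ n, F.map (K.obj n).mor₁ ≫ β.app n = α.app n ≫ f) :
    ∃ γ : SeqCocone F (K ⋙ Triangle.π₃) C,
      (∀ n, F.map (K.obj n).mor₂ ≫ γ.app n = β.app n ≫ g) ∧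
      (∀ n, (F.map (K.obj n).mor₃ ≫ (F.commShiftIso (1 : ℤ)).hom.app (K.obj n).obj₁) ≫
        (α.app n)⟦(1 : ℤ)⟧' = γ.app n ≫ δ) := by
  have hC : supported M F C := supported_cone _ hT hA hB
  have hA₁ := supported_shift hA 1
  obtain ⟨N₁, hN₁⟩ := h₃.exists_bijective_app hC
  obtain ⟨N₂, hN₂⟩ := h₂.exists_bijective_app hC
  obtain ⟨N₃, hN₃⟩ := h₃.exists_bijective_app hA₁
  let N := max N₁ (max N₂ N₃)
  obtain ⟨c, hc₂, hc₃⟩ : ∃ c : F.obj (K.obj N).obj₃ ⟶ C,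
      F.map (K.obj N).mor₂ ≫ c = β.app N ≫ g ∧
      (F.map (K.obj N).mor₃ ≫ (F.commShiftIso (1 : ℤ)).hom.app (K.obj N).obj₁) ≫
        (α.app N)⟦(1 : ℤ)⟧' = c ≫ δ :=
    complete_distinguished_triangle_morphism _ _ (F.map_distinguished _ (hK N)) hT
      (α.app N) (β.app N) (comm N)
  obtain ⟨γ, hγ⟩ := (hN₁ N (le_max_left _ _)).2 c
  dsimp only at hγ
  refine ⟨γ, fun n => ?_, fun n => ?_⟩
  · refine SeqCocone.hom_ext_of_bijective (hN₂ N ((le_max_left _ _).trans (le_max_right _ _)))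
      (γ := γ.precomp (Functor.whiskerLeft K Triangle.π₂Toπ₃)) (γ' := β.comp g) ?_ n
    change F.map (K.obj N).mor₂ ≫ γ.app N = β.app N ≫ g
    rw [hγ, hc₂]
  · refine (Category.assoc _ _ _).trans (SeqCocone.hom_ext_of_bijective
      (hN₃ N ((le_max_right _ _).trans (le_max_right _ _)))
      (γ := (α.shift 1).precomp (Functor.whiskerLeft K Triangle.π₃Toπ₁)) (γ' := γ.comp δ) ?_ n)
    have h := congrArg (fun k : F.obj (K.obj N).obj₃ ⟶ C => k ≫ δ) hγ
    exact ((Category.assoc _ _ _).symm.trans hc₃).trans h.symm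

/-- If the colimits of the first two terms of a sequence of distinguished triangles are supported,
then so is that of the third. The points `A`, `B`, `C` are not assumed to form a triangle: the
argument is a diagram chase in the sequence. -/
lemma supported_of_isYonedaColimit (hF : IsGoodExtension M F)
    (hK : ∀ n, K.obj n ∈ distTriang S) {α : SeqCocone F (K ⋙ Triangle.π₁) A}
    {β : SeqCocone F (K ⋙ Triangle.π₂) B} {γ : SeqCocone F (K ⋙ Triangle.π₃) C}
    (hα : α.IsYonedaColimit) (hβ : β.IsYonedaColimit) (hγ : γ.IsYonedaColimit)
    (hA : supported M F A) (hB : supported M F B) : supported M F C := by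
  have hα₁ := hα.shift hF 1
  have hA₁ := supported_shift hA 1
  rw [supported_iff] at hA₁ hB ⊢
  intro j
  obtain ⟨i, hi⟩ := hA₁ j
  obtain ⟨i', hi'⟩ := hB j
  refine ⟨max i i', fun s hs => (hγ.forall_eq_zero_iff _).2
    fun n (x : s⟦j⟧ ⟶ (K.obj n).obj₃) => ?_⟩
  obtain ⟨m, hm, hx⟩ := (hα₁.forall_eq_zero_iff _).1
    (hi s (M.antitone (le_max_left i i') _ hs)) n (x ≫ (K.obj n).mor₃)
  -- at stage `m` the map comes from the middle term, where it dies later on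
  obtain ⟨y, hy⟩ := Triangle.coyoneda_exact₃ _ (hK m) (x ≫ (K.map (homOfLE hm)).hom₃) (by
    rw [Category.assoc, ← (K.map (homOfLE hm)).comm₃, ← Category.assoc]
    exact hx)
  obtain ⟨p, hp, hy'⟩ := (hβ.forall_eq_zero_iff _).1
    (hi' s (M.antitone (le_max_right i i') _ hs)) m y
  refine ⟨p, hm.trans hp, ?_⟩
  change y ≫ (K.map (homOfLE hp)).hom₂ = 0 at hy'
  change x ≫ (K.map (homOfLE hm ≫ homOfLE hp)).hom₃ = 0
  rw [K.map_comp, comp_hom₃, ← Category.assoc, hy, Category.assoc, (K.map (homOfLE hp)).comm₂,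
    reassoc_of% hy', zero_comp]

/-- The cone of a map of homotopy colimits induced by a map of Cauchy sequences is the homotopy
colimit of the cones. It has the same maps to supported objects by the five lemma, and a supported
object is determined by these. -/
lemma exists_colimit_seqCocone₃ [HasCoproducts.{w} T] (hF : IsGoodExtension M F)
    (hK : ∀ n, K.obj n ∈ distTriang S) (h₁ : IsCauchy M (K ⋙ Triangle.π₁))
    (h₂ : IsCauchy M (K ⋙ Triangle.π₂)) (h₃ : IsCauchy M (K ⋙ Triangle.π₃))
    (hT : Triangle.mk f g δ ∈ distTriang T) (hA : supported M F A) (hB : supported M F B)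
    {α : SeqCocone F (K ⋙ Triangle.π₁) A} {β : SeqCocone F (K ⋙ Triangle.π₂) B}
    (hα : IsSupportedColimit M α) (hα' : α.IsYonedaColimit)
    (hβ : IsSupportedColimit M β) (hβ' : β.IsYonedaColimit)
    (comm : ∀ n, F.map (K.obj n).mor₁ ≫ β.app n = α.app n ≫ f) :
    ∃ γ : SeqCocone F (K ⋙ Triangle.π₃) C,
      (∀ n, F.map (K.obj n).mor₂ ≫ γ.app n = β.app n ≫ g) ∧
      (∀ n, (F.map (K.obj n).mor₃ ≫ (F.commShiftIso (1 : ℤ)).hom.app (K.obj n).obj₁) ≫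
        (α.app n)⟦(1 : ℤ)⟧' = γ.app n ≫ δ) ∧ γ.IsYonedaColimit ∧ completion' M F C := by
  obtain ⟨γ, hγ₂, hγ₃⟩ := exists_seqCocone₃ hK h₂ h₃ hT hA hB α β comm
  have hγ : IsSupportedColimit M γ := by
    refine .of_exists_bijective h₃ fun X hX => ?_
    obtain ⟨N₁, hN₁⟩ := hα.exists_bijective h₁ hX
    obtain ⟨N₂, hN₂⟩ := hβ.exists_bijective h₂ hX
    obtain ⟨N₃, hN₃⟩ := hα.exists_bijective_shift h₁ 1 hX
    obtain ⟨N₄, hN₄⟩ := hβ.exists_bijective_shift h₂ 1 hX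
    refine ⟨max (max N₁ N₂) (max N₃ N₄), fun n hn => ?_⟩
    simp only [max_le_iff] at hn
    exact bijective_comp₃ (map_distTriang F (hK n)) hT (comm n) (hγ₂ n) (hγ₃ n)
      (hN₁ n hn.1.1) (hN₂ n hn.1.2) (hN₃ n hn.2.1) (hN₄ n hn.2.2)
  obtain ⟨h⟩ := nonempty_homotopyColimit.{w} ((K ⋙ Triangle.π₃) ⋙ F)
  have hC := hγ.completion' hF h₃ (supported_cone _ hT hA hB) h
    (supported_of_isYonedaColimit hF hK hα' hβ' (hF.isYonedaColimit h₃ h) hA hB)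
  exact ⟨γ, hγ₂, hγ₃, hC.2, hC.1⟩

end

/-! ### Cauchy sequences of triangles -/

/-- The subcategories of a metric are closed under extensions. -/
lemma Metric.obj_of_distTriang (i : ℕ) (j : ℤ) {X Y Z : S} {f : X ⟶ Y} {g : Y ⟶ Z}
    {h : Z ⟶ X⟦(1 : ℤ)⟧} (hT : Triangle.mk f g h ∈ distTriang S) (hX : M.obj i (X⟦j⟧))
    (hZ : M.obj i (Z⟦j⟧)) : M.obj i (Y⟦j⟧) := by
  rw [← M.star_self i]
  exact ⟨_, _, _, _, _, Triangle.shift_distinguished _ hT j, hX, hZ⟩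

/-- Membership of the cone in `M i` does not depend on the choice of the cone. -/
lemma Metric.obj_cone_congr (i : ℕ) (j : ℤ) {X Y Z Z' : S} {f : X ⟶ Y} {g : Y ⟶ Z}
    {h : Z ⟶ X⟦(1 : ℤ)⟧} {g' : Y ⟶ Z'} {h' : Z' ⟶ X⟦(1 : ℤ)⟧}
    (hT : Triangle.mk f g h ∈ distTriang S) (hT' : Triangle.mk f g' h' ∈ distTriang S)
    (hZ : M.obj i (Z⟦j⟧)) : M.obj i (Z'⟦j⟧) := by
  have := M.isClosedUnderIsomorphisms i
  let e := isoTriangleOfIso₁₂ _ _ hT hT' (Iso.refl _) (Iso.refl _)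
    ((Category.comp_id _).trans (Category.id_comp _).symm)
  exact (M.obj i).prop_of_iso ((shiftFunctor S j).mapIso (Triangle.π₃.mapIso e)) hZ

lemma IsCauchy.reindex {E : ℕ ⥤ S} (hE : IsCauchy M E) {k : ℕ → ℕ} (hk : StrictMono k) :
    IsCauchy M (hk.monotone.functor ⋙ E) := by
  intro i j
  obtain ⟨N, hN⟩ := hE i j
  exact ⟨N, fun m m' hm h D g δ hD =>
    hN (k m) (k m') (hm.trans (hk.id_le m)) (hk h) D g δ hD⟩

section

variable [IsTriangulated S]

/-- The Cauchy condition may be checked on the consecutive maps of a sequence: the cone of a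
composition is an extension of the cones of the factors. -/
lemma isCauchy_of_succ {E : ℕ ⥤ S} (h : ∀ (i : ℕ) (j : ℤ), ∃ N : ℕ, ∀ n : ℕ, N ≤ n →
    ∃ (D : S) (g : E.obj (n + 1) ⟶ D) (δ : D ⟶ (E.obj n)⟦(1 : ℤ)⟧),
      Triangle.mk (E.map (homOfLE n.le_succ)) g δ ∈ distTriang S ∧ M.obj i (D⟦j⟧)) :
    IsCauchy M E := by
  intro i j
  obtain ⟨N, hN⟩ := h i j
  refine ⟨N, fun m m' hm h => ?_⟩
  induction m', (show m + 1 ≤ m' from h) using Nat.le_induction with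
  | base =>
    intro D g δ hD
    obtain ⟨D', g', δ', hD', hj⟩ := hN m hm
    exact Metric.obj_cone_congr i j hD' hD hj
  | succ m' hmm' ih =>
    intro D g δ hD
    obtain ⟨D₁, g₁, δ₁, hD₁⟩ := distinguished_cocone_triangle
      (E.map (homOfLE (show m ≤ m' by lia)))
    obtain ⟨D₂, g₂, δ₂, hD₂, hj⟩ := hN m' (by lia)
    have comm : E.map (homOfLE (show m ≤ m' by lia)) ≫ E.map (homOfLE m'.le_succ) =
        E.map (homOfLE h.le) := by
      rw [← E.map_comp]
      rfl
    exact Metric.obj_of_distTriang i j (Triangulated.someOctahedron comm hD₁ hD₂ hD).mem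
      (ih (by lia) _ _ _ hD₁) hj

/-- The `3 × 3` lemma: a commutative square extends to a morphism of distinguished triangles in
such a way that the cones of its components form a distinguished triangle. -/
lemma exists_morphism_cones {X Y Z X' Y' Z' A B : S}
    {f : X ⟶ Y} {g : Y ⟶ Z} {h : Z ⟶ X⟦(1 : ℤ)⟧} (hT : Triangle.mk f g h ∈ distTriang S)
    {f' : X' ⟶ Y'} {g' : Y' ⟶ Z'} {h' : Z' ⟶ X'⟦(1 : ℤ)⟧}
    (hT' : Triangle.mk f' g' h' ∈ distTriang S)
    {a : X ⟶ X'} {a₂ : X' ⟶ A} {a₃ : A ⟶ X⟦(1 : ℤ)⟧} (ha : Triangle.mk a a₂ a₃ ∈ distTriang S)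
    {b : Y ⟶ Y'} {b₂ : Y' ⟶ B} {b₃ : B ⟶ Y⟦(1 : ℤ)⟧} (hb : Triangle.mk b b₂ b₃ ∈ distTriang S)
    (comm : a ≫ f' = f ≫ b) :
    ∃ (c : Z ⟶ Z') (C : S) (c₂ : Z' ⟶ C) (c₃ : C ⟶ Z⟦(1 : ℤ)⟧)
      (u : B ⟶ C) (v : C ⟶ A⟦(1 : ℤ)⟧) (w : A⟦(1 : ℤ)⟧ ⟶ B⟦(1 : ℤ)⟧),
      g ≫ c = b ≫ g' ∧ h ≫ a⟦(1 : ℤ)⟧' = c ≫ h' ∧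
      Triangle.mk c c₂ c₃ ∈ distTriang S ∧ Triangle.mk u v w ∈ distTriang S := by
  -- both `Z ⟶ Z'` and its cone are built from the cone `W` of the diagonal `X ⟶ Y'`
  obtain ⟨W, p, q, hW⟩ := distinguished_cocone_triangle (f ≫ b)
  let o := Triangulated.someOctahedron rfl hT hb hW
  let o' := Triangulated.someOctahedron comm ha hT' hW
  obtain ⟨C, c₂, c₃, hC⟩ := distinguished_cocone_triangle (o.m₁ ≫ o'.m₃)
  let o'' := Triangulated.someOctahedron rfl o.mem (rot_of_distTriang _ o'.mem) hC
  refine ⟨o.m₁ ≫ o'.m₃, C, c₂, c₃, o''.m₁, o''.m₃, _, ?_, ?_, hC, o''.mem⟩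
  · rw [o.comm₁_assoc, o'.comm₃]
  · rw [Category.assoc, ← o'.comm₄, o.comm₂_assoc]

/-- The cones of the components of a morphism of Cauchy sequences can be arranged into a Cauchy
sequence. -/
lemma exists_cauchy_cones {E E' : ℕ ⥤ S} (hE : IsCauchy M E) (hE' : IsCauchy M E')
    (φ : E ⟶ E') :
    ∃ (C : ℕ ⥤ S) (ψ : E' ⟶ C) (χ : C ⟶ E ⋙ shiftFunctor S (1 : ℤ)),
      (∀ n, Triangle.mk (φ.app n) (ψ.app n) (χ.app n) ∈ distTriang S) ∧ IsCauchy M C := by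
  choose Z ψ χ hZ using fun n => distinguished_cocone_triangle (φ.app n)
  choose A a₂ a₃ hA using fun n =>
    distinguished_cocone_triangle (E.map (homOfLE (Nat.le_succ n)))
  choose B b₂ b₃ hB using fun n =>
    distinguished_cocone_triangle (E'.map (homOfLE (Nat.le_succ n)))
  choose c C c₂ c₃ u v w hψ hχ hC hABC using fun n =>
    exists_morphism_cones (hZ n) (hZ (n + 1)) (hA n) (hB n) (φ.naturality _)
  have hc (n : ℕ) : (Functor.ofSequence c).map (homOfLE n.le_succ) = c n :=
    Functor.ofSequence_map_homOfLE_succ c n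
  refine ⟨Functor.ofSequence c,
    NatTrans.ofSequence ψ fun n => ((congrArg (ψ n ≫ ·) (hc n)).trans (hψ n)).symm,
    NatTrans.ofSequence χ fun n =>
      (congrArg (· ≫ χ (n + 1)) (hc n)).trans (hχ n).symm, hZ, ?_⟩
  refine isCauchy_of_succ fun i j => ?_
  have := M.isClosedUnderIsomorphisms i
  obtain ⟨N, hN⟩ := hE i (1 + j)
  obtain ⟨N', hN'⟩ := hE' i j
  refine ⟨max N N', fun n hn => ⟨C n, c₂ n, c₃ n, ?_, ?_⟩⟩
  · rw [hc]
    exact hC n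
  · refine Metric.obj_of_distTriang i j (hABC n)
      (hN' n (n + 1) (by lia) n.lt_succ_self _ _ _ (hB n)) ?_
    exact (M.obj i).prop_of_iso ((shiftFunctorAdd S 1 j).app (A n))
      (hN n (n + 1) (by lia) n.lt_succ_self _ _ _ (hA n))

end

/-! ### Presenting maps and triangles by Cauchy sequences -/

section

variable {E E' : ℕ ⥤ S} {A B C : T}

/-- The restriction of a cocone to a subsequence. -/
def SeqCocone.reindex (α : SeqCocone F E A) {k : ℕ → ℕ} (hk : StrictMono k) :
    SeqCocone F (hk.monotone.functor ⋙ E) A where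
  app n := α.app (k n)
  w h := α.w (hk.monotone h)

lemma SeqCocone.IsYonedaColimit.reindex {α : SeqCocone F E A} (hα : α.IsYonedaColimit)
    {k : ℕ → ℕ} (hk : StrictMono k) : (α.reindex hk).IsYonedaColimit := by
  refine fun s => ⟨fun x => ?_, fun n (f : s ⟶ E.obj (k n)) hf => ?_⟩
  · obtain ⟨n, f, rfl⟩ := (hα s).1 x
    exact ⟨n, f ≫ E.map (homOfLE (hk.id_le n)), by
      rw [F.map_comp, Category.assoc]
      exact congrArg (F.map f ≫ ·) (α.w (hk.id_le n))⟩
  · obtain ⟨m, hm, h⟩ := (hα s).2 (k n) f hf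
    have hm' : m ≤ k (max n m) := (le_max_right n m).trans (hk.id_le _)
    refine ⟨max n m, le_max_left n m, ?_⟩
    change f ≫ E.map (homOfLE hm ≫ homOfLE hm') = 0
    rw [E.map_comp, reassoc_of% h, zero_comp]

lemma IsSupportedColimit.reindex (hE : IsCauchy M E) {α : SeqCocone F E A}
    (hα : IsSupportedColimit M α) {k : ℕ → ℕ} (hk : StrictMono k) :
    IsSupportedColimit M (α.reindex hk) := by
  refine .of_exists_bijective (hE.reindex hk) fun X hX => ?_
  obtain ⟨N, hN⟩ := hα.exists_bijective hE hX
  exact ⟨N, fun n hn => hN (k n) (hn.trans (hk.id_le n))⟩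

/-- A map between colimits of Cauchy sequences is induced by a morphism to a subsequence. -/
lemma exists_natTrans (α : SeqCocone F E A) {β : SeqCocone F E' B}
    (hβ : β.IsYonedaColimit) (f : A ⟶ B) :
    ∃ (k : ℕ → ℕ) (hk : StrictMono k) (φ : E ⟶ hk.monotone.functor ⋙ E'),
      ∀ n, F.map (φ.app n) ≫ (β.reindex hk).app n = α.app n ≫ f := by
  -- the objects and maps of the subsequence are chosen recursively, `P n` being the type of
  -- candidates for the `n`-th step
  let P (n : ℕ) := Σ k : ℕ, { g : E.obj n ⟶ E'.obj k // F.map g ≫ β.app k = α.app n ≫ f }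
  have step (n : ℕ) (x : P n) : ∃ (y : P (n + 1)) (hxy : x.1 < y.1),
      E.map (homOfLE n.le_succ) ≫ y.2.1 = x.2.1 ≫ E'.map (homOfLE hxy.le) := by
    obtain ⟨k, g, hg⟩ := x
    obtain ⟨l, g', hg'⟩ := (hβ _).1 (α.app (n + 1) ≫ f)
    obtain ⟨p, hk, hl, h⟩ := hβ.exists_comp_eq g (E.map (homOfLE n.le_succ) ≫ g') (by
      rw [hg, F.map_comp, Category.assoc, hg', α.w_assoc])
    -- `p + 1` instead of `p` makes the sequence of indices strictly increasing
    refine ⟨⟨p + 1, g' ≫ E'.map (homOfLE (hl.trans p.le_succ)), ?_⟩, Nat.lt_succ_of_le hk, ?_⟩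
    · rw [F.map_comp, Category.assoc, β.w, hg']
    · change _ ≫ g' ≫ E'.map (homOfLE hl ≫ homOfLE p.le_succ) =
        g ≫ E'.map (homOfLE hk ≫ homOfLE p.le_succ)
      rw [E'.map_comp, E'.map_comp, reassoc_of% h]
  choose σ hσ hσ' using step
  obtain ⟨k₀, g₀, hg₀⟩ := (hβ _).1 (α.app 0 ≫ f)
  let x (n : ℕ) : P n := Nat.rec ⟨k₀, g₀, hg₀⟩ (fun n y => σ n y) n
  have hk : StrictMono (fun n => (x n).1) := strictMono_nat_of_lt_succ fun n => hσ n (x n)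
  exact ⟨_, hk, NatTrans.ofSequence (fun n => (x n).2.1) fun n => hσ' n (x n),
    fun n => (x n).2.2⟩

/-- Every distinguished triangle of `T` on a map of `𝔏'(S) ∩ 𝒴⁻¹(ℭ(S))` is the colimit of a Cauchy
sequence of distinguished triangles of `S`. -/
lemma exists_cauchy_triangles [IsTriangulated S] [HasCoproducts.{w} T]
    (hF : IsGoodExtension M F) {f : A ⟶ B} {g : B ⟶ C} {δ : C ⟶ A⟦(1 : ℤ)⟧}
    (hT : Triangle.mk f g δ ∈ distTriang T) (hA : completion' M F A) (hB : completion' M F B) :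
    completion' M F C ∧ ∃ K : ℕ ⥤ Triangle S, (∀ n, K.obj n ∈ distTriang S) ∧
      IsCauchy M (K ⋙ Triangle.π₁) ∧ IsCauchy M (K ⋙ Triangle.π₂) ∧
      IsCauchy M (K ⋙ Triangle.π₃) ∧ ∃ (α : SeqCocone F (K ⋙ Triangle.π₁) A)
        (β : SeqCocone F (K ⋙ Triangle.π₂) B) (γ : SeqCocone F (K ⋙ Triangle.π₃) C),
        α.IsYonedaColimit ∧ β.IsYonedaColimit ∧ γ.IsYonedaColimit ∧
        (∀ n, F.map (K.obj n).mor₁ ≫ β.app n = α.app n ≫ f) ∧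
        (∀ n, F.map (K.obj n).mor₂ ≫ γ.app n = β.app n ≫ g) ∧
        (∀ n, (F.map (K.obj n).mor₃ ≫ (F.commShiftIso (1 : ℤ)).hom.app (K.obj n).obj₁) ≫
          (α.app n)⟦(1 : ℤ)⟧' = γ.app n ≫ δ) := by
  obtain ⟨E, hE, α, hα, hα'⟩ := hA.exists_seqCocone hF
  obtain ⟨E', hE', β, hβ, hβ'⟩ := hB.exists_seqCocone hF
  obtain ⟨k, hk, φ, hφ⟩ := exists_natTrans α hβ' f
  obtain ⟨D, ψ, χ, hK, hD⟩ := exists_cauchy_cones hE (hE'.reindex hk) φ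
  let K := Triangle.functorMk φ ψ χ
  obtain ⟨γ, hγ₂, hγ₃, hγ, hC⟩ := exists_colimit_seqCocone₃ (K := K) (α := α)
    (β := β.reindex hk) hF hK hE (hE'.reindex hk) hD hT hA.2 hB.2 hα hα' (hβ.reindex hE' hk)
    (hβ'.reindex hk) hφ
  exact ⟨hC, K, hK, hE, hE'.reindex hk, hD, α, β.reindex hk, γ, hα', hβ'.reindex hk, hγ, hφ,
    hγ₂, hγ₃⟩

end

/-! ### Compatibility of the Yoneda functors with shifts -/

section

open scoped Pretriangulated.Opposite

variable (F)

/-- A functor commuting with shifts respects the bijections `Hom(s⟦-n⟧, A) ≃ Hom(s, A⟦n⟧)`. -/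
lemma yonedaShiftEquiv_map (A : S) (n : ℤ) (s : Sᵒᵖ) (g : (s⟦n⟧ : Sᵒᵖ).unop ⟶ A) :
    F.map (yonedaShiftEquiv A n s g) ≫ (F.commShiftIso n).hom.app A =
      yonedaShiftEquiv (F.obj A) n (F.op.obj s)
        (((F.op.commShiftIso n).hom.app s).unop ≫ F.map g) := by
  change F.map (((opShiftFunctorEquivalence S n).unitIso.inv.app s).unop ≫ g⟦n⟧') ≫ _ =
    ((opShiftFunctorEquivalence T n).unitIso.inv.app (F.op.obj s)).unop ≫
      (((F.op.commShiftIso n).hom.app s).unop ≫ F.map g)⟦n⟧'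
  have h := (F.commShiftIso n).hom.naturality g
  dsimp at h
  rw [F.map_comp, Category.assoc, h, F.map_opShiftFunctorEquivalence_unitIso_inv_app_unop,
    Functor.map_comp]
  simp

/-- The shift isomorphisms of a functor lifted to a full subcategory are those of the functor. -/
lemma ι_map_lift_commShiftIso_hom_app {C D : Type*} [Category* C] [Category* D] [HasShift C ℤ]
    [HasShift D ℤ] (P : ObjectProperty D) [P.IsStableUnderShift ℤ] (G : C ⥤ D) [G.CommShift ℤ]
    (hG : ∀ X, P (G.obj X)) (n : ℤ) (X : C) :
    P.ι.map (((P.lift G hG).commShiftIso n).hom.app X) ≫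
      (P.ι.commShiftIso n).hom.app ((P.lift G hG).obj X) = (G.commShiftIso n).hom.app X := by
  have h := Functor.CommShift.OfComp.map_iso_hom_app (P.liftCompιIso G hG) n X
  refine (congrArg (· ≫ (P.ι.commShiftIso n).hom.app ((P.lift G hG).obj X)) h).trans ?_
  simp only [Category.assoc, Iso.inv_hom_id_app]
  change 𝟙 _ ≫ (G.commShiftIso n).hom.app X ≫ (𝟙 (G.obj X))⟦n⟧' ≫ 𝟙 ((G.obj X)⟦n⟧) = _
  simp

/-- The natural transformation with components `preadditiveYonedaMap F A` is compatible with the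
shifts. It underlies `Y ⟶ 𝒴 ∘ F`; here all functors take values in presheaves of abelian groups,
where the shift isomorphisms are explicit. -/
lemma preadditiveYonedaMap_shift (n : ℤ) (A : S) :
    ((preadditiveYoneda (C := S)).commShiftIso n).hom.app A ≫ (preadditiveYonedaMap F A)⟦n⟧' =
      preadditiveYonedaMap F (A⟦n⟧) ≫ (preadditiveYoneda ⋙
        (Functor.whiskeringLeft Sᵒᵖ Tᵒᵖ AddCommGrpCat.{v}).obj F.op).map
          ((F.commShiftIso n).hom.app A) ≫
        ((preadditiveYoneda ⋙ (Functor.whiskeringLeft Sᵒᵖ Tᵒᵖ AddCommGrpCat.{v}).obj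
          F.op).commShiftIso n).hom.app (F.obj A) := by
  rw [← cancel_epi (((preadditiveYoneda (C := S)).commShiftIso n).inv.app A),
    Iso.inv_hom_id_app_assoc, ← Category.assoc, ← Category.assoc, ← Iso.app_hom _ (F.obj A),
    ← Iso.comp_inv_eq]
  ext s (g : (s⟦n⟧ : Sᵒᵖ).unop ⟶ A)
  exact (yonedaShiftEquiv_map F A n s g).symm

/-- The natural transformation `Y ⟶ 𝒴 ∘ F` is compatible with the shifts. -/
lemma yonedaToRestricted_shift (n : ℤ) (A : S) :
    ((yonedaMod S).commShiftIso n).hom.app A ≫ ((yonedaToRestricted F).app A)⟦n⟧' =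
      (yonedaToRestricted F).app (A⟦n⟧) ≫ (restrictedYoneda F).map ((F.commShiftIso n).hom.app A) ≫
        ((restrictedYoneda F).commShiftIso n).hom.app (F.obj A) := by
  let ι := (additiveFunctor Sᵒᵖ AddCommGrpCat.{v}).ι
  apply ι.map_injective
  rw [← cancel_mono ((ι.commShiftIso n).hom.app _)]
  have h₁ := ι_map_lift_commShiftIso_hom_app (additiveFunctor Sᵒᵖ AddCommGrpCat.{v})
    (preadditiveYoneda (C := S)) (fun A => inferInstanceAs (preadditiveYoneda.obj A).Additive) n A
  have h₂ := ι_map_lift_commShiftIso_hom_app (additiveFunctor Sᵒᵖ AddCommGrpCat.{v})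
    (preadditiveYoneda ⋙ (Functor.whiskeringLeft Sᵒᵖ Tᵒᵖ AddCommGrpCat.{v}).obj F.op)
    (fun A => inferInstanceAs (F.op ⋙ preadditiveYoneda.obj A).Additive) n (F.obj A)
  have h₃ := (ι.commShiftIso n).hom.naturality ((yonedaToRestricted F).app A)
  rw [ι.map_comp, ι.map_comp, ι.map_comp]
  simp only [Category.assoc]
  refine (congrArg (_ ≫ ·) h₃).trans ?_
  refine Eq.trans ?_ (congrArg (_ ≫ _ ≫ ·) h₂).symm
  refine (Category.assoc _ _ _).symm.trans ((congrArg (· ≫ _) h₁).trans ?_)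
  exact preadditiveYonedaMap_shift F n A

end

/-! ### Colimits of sequences of triangles -/

/-- A square with top row in `S` and bottom row in `T` gives a square in `Mod S`. -/
lemma map_comp_yonedaToRestricted {s t : S} {A B : T} {k : s ⟶ t} {u : F.obj s ⟶ A}
    {v : F.obj t ⟶ B} {w : A ⟶ B} (h : F.map k ≫ v = u ≫ w) :
    (yonedaMod S).map k ≫ (yonedaToRestricted F).app t ≫ (restrictedYoneda F).map v =
      ((yonedaToRestricted F).app s ≫ (restrictedYoneda F).map u) ≫ (restrictedYoneda F).map w := by
  rw [(yonedaToRestricted F).naturality_assoc, Category.assoc, Functor.comp_map, ← Functor.map_comp,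
    ← Functor.map_comp, h]

/-- The analogue of `map_comp_yonedaToRestricted` for the third maps of triangles. -/
lemma map_comp_yonedaToRestricted_shift {s t : S} {A B : T} {k : s ⟶ t⟦(1 : ℤ)⟧} {u : F.obj s ⟶ A}
    {v : F.obj t ⟶ B} {w : A ⟶ B⟦(1 : ℤ)⟧}
    (h : (F.map k ≫ (F.commShiftIso (1 : ℤ)).hom.app t) ≫ v⟦(1 : ℤ)⟧' = u ≫ w) :
    ((yonedaMod S).map k ≫ ((yonedaMod S).commShiftIso (1 : ℤ)).hom.app t) ≫
        ((yonedaToRestricted F).app t ≫ (restrictedYoneda F).map v)⟦(1 : ℤ)⟧' =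
      ((yonedaToRestricted F).app s ≫ (restrictedYoneda F).map u) ≫ (restrictedYoneda F).map w ≫
        ((restrictedYoneda F).commShiftIso (1 : ℤ)).hom.app B := by
  have h₁ := yonedaToRestricted_shift F 1 t
  have h₂ := ((restrictedYoneda F).commShiftIso (1 : ℤ)).hom.naturality v
  have h₃ := map_comp_yonedaToRestricted (F := F) (t := t⟦(1 : ℤ)⟧)
    (v := (F.commShiftIso (1 : ℤ)).hom.app t ≫ v⟦(1 : ℤ)⟧') ((Category.assoc _ _ _).symm.trans h)
  rw [Functor.map_comp] at h₃
  simp only [Category.assoc] at h₃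
  rw [Functor.map_comp, Category.assoc, reassoc_of% h₁]
  simp only [Category.assoc]
  refine (congrArg (_ ≫ _ ≫ _ ≫ ·) h₂.symm).trans ?_
  simpa only [Functor.comp_map, Category.assoc] using
    congrArg (· ≫ ((restrictedYoneda F).commShiftIso (1 : ℤ)).hom.app B) h₃

/-- Two cocones of triangles whose three components are colimit cocones have isomorphic points. -/
lemma nonempty_iso_of_isColimit {J D : Type*} [Category* J] [Category* D] [HasShift D ℤ]
    {K : J ⥤ Triangle D} {c c' : Cocone K}
    (h₁ : IsColimit (Triangle.π₁.mapCocone c)) (h₂ : IsColimit (Triangle.π₂.mapCocone c))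
    (h₃ : IsColimit (Triangle.π₃.mapCocone c)) (h₁' : IsColimit (Triangle.π₁.mapCocone c'))
    (h₂' : IsColimit (Triangle.π₂.mapCocone c')) (h₃' : IsColimit (Triangle.π₃.mapCocone c')) :
    Nonempty (c.pt ≅ c'.pt) := by
  let e₁ : c.pt.obj₁ ≅ c'.pt.obj₁ := h₁.coconePointUniqueUpToIso h₁'
  let e₂ : c.pt.obj₂ ≅ c'.pt.obj₂ := h₂.coconePointUniqueUpToIso h₂'
  let e₃ : c.pt.obj₃ ≅ c'.pt.obj₃ := h₃.coconePointUniqueUpToIso h₃'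
  have he₁ (j : J) : (c.ι.app j).hom₁ ≫ e₁.hom = (c'.ι.app j).hom₁ :=
    h₁.comp_coconePointUniqueUpToIso_hom h₁' j
  have he₂ (j : J) : (c.ι.app j).hom₂ ≫ e₂.hom = (c'.ι.app j).hom₂ :=
    h₂.comp_coconePointUniqueUpToIso_hom h₂' j
  have he₃ (j : J) : (c.ι.app j).hom₃ ≫ e₃.hom = (c'.ι.app j).hom₃ :=
    h₃.comp_coconePointUniqueUpToIso_hom h₃' j
  refine ⟨Triangle.isoMk _ _ e₁ e₂ e₃ (h₁.hom_ext fun j => ?_) (h₂.hom_ext fun j => ?_)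
    (h₃.hom_ext fun j => ?_)⟩
  · have k : (K.obj j).mor₁ ≫ (c.ι.app j).hom₂ = (c.ι.app j).hom₁ ≫ c.pt.mor₁ := (c.ι.app j).comm₁
    have k' : (K.obj j).mor₁ ≫ (c'.ι.app j).hom₂ = (c'.ι.app j).hom₁ ≫ c'.pt.mor₁ :=
      (c'.ι.app j).comm₁
    change (c.ι.app j).hom₁ ≫ c.pt.mor₁ ≫ e₂.hom = (c.ι.app j).hom₁ ≫ e₁.hom ≫ c'.pt.mor₁
    rw [reassoc_of% he₁, ← k', ← he₂, reassoc_of% k]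
  · have k : (K.obj j).mor₂ ≫ (c.ι.app j).hom₃ = (c.ι.app j).hom₂ ≫ c.pt.mor₂ := (c.ι.app j).comm₂
    have k' : (K.obj j).mor₂ ≫ (c'.ι.app j).hom₃ = (c'.ι.app j).hom₂ ≫ c'.pt.mor₂ :=
      (c'.ι.app j).comm₂
    change (c.ι.app j).hom₂ ≫ c.pt.mor₂ ≫ e₃.hom = (c.ι.app j).hom₂ ≫ e₂.hom ≫ c'.pt.mor₂
    rw [reassoc_of% he₂, ← k', ← he₃, reassoc_of% k]
  · have k : (K.obj j).mor₃ ≫ (c.ι.app j).hom₁⟦(1 : ℤ)⟧' = (c.ι.app j).hom₃ ≫ c.pt.mor₃ :=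
      (c.ι.app j).comm₃
    have k' : (K.obj j).mor₃ ≫ (c'.ι.app j).hom₁⟦(1 : ℤ)⟧' = (c'.ι.app j).hom₃ ≫ c'.pt.mor₃ :=
      (c'.ι.app j).comm₃
    have he : (c.ι.app j).hom₁⟦(1 : ℤ)⟧' ≫ e₁.hom⟦(1 : ℤ)⟧' = (c'.ι.app j).hom₁⟦(1 : ℤ)⟧' :=
      ((shiftFunctor D (1 : ℤ)).map_comp _ _).symm.trans (congrArg _ (he₁ j))
    change (c.ι.app j).hom₃ ≫ c.pt.mor₃ ≫ e₁.hom⟦(1 : ℤ)⟧' =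
      (c.ι.app j).hom₃ ≫ e₃.hom ≫ c'.pt.mor₃
    rw [reassoc_of% he₃, ← k', ← he, reassoc_of% k]

section

variable {K : ℕ ⥤ Triangle S} {A B C : T} {f : A ⟶ B} {g : B ⟶ C} {δ : C ⟶ A⟦(1 : ℤ)⟧}
  (α : SeqCocone F (K ⋙ Triangle.π₁) A) (β : SeqCocone F (K ⋙ Triangle.π₂) B)
  (γ : SeqCocone F (K ⋙ Triangle.π₃) C)
  (comm₁ : ∀ n, F.map (K.obj n).mor₁ ≫ β.app n = α.app n ≫ f)
  (comm₂ : ∀ n, F.map (K.obj n).mor₂ ≫ γ.app n = β.app n ≫ g)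
  (comm₃ : ∀ n, (F.map (K.obj n).mor₃ ≫ (F.commShiftIso (1 : ℤ)).hom.app (K.obj n).obj₁) ≫
    (α.app n)⟦(1 : ℤ)⟧' = γ.app n ≫ δ)

/-- The cocone in the category of triangles of `Mod S` whose components are the cocones
`α.yonedaCocone`, `β.yonedaCocone` and `γ.yonedaCocone`. -/
def triangleCocone : Cocone (K ⋙ (yonedaMod S).mapTriangle) where
  pt := (restrictedYoneda F).mapTriangle.obj (Triangle.mk f g δ)
  ι :=
    { app n :=
        { hom₁ := α.yonedaCocone.ι.app n
          hom₂ := β.yonedaCocone.ι.app n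
          hom₃ := γ.yonedaCocone.ι.app n
          comm₁ := map_comp_yonedaToRestricted (comm₁ n)
          comm₂ := map_comp_yonedaToRestricted (comm₂ n)
          comm₃ := map_comp_yonedaToRestricted_shift (comm₃ n) }
      naturality n m i := by
        ext1
        · exact α.yonedaCocone.ι.naturality i
        · exact β.yonedaCocone.ι.naturality i
        · exact γ.yonedaCocone.ι.naturality i }

end

/-! ### The triangulated subcategory `𝔏'(S) ∩ 𝒴⁻¹(ℭ(S))` -/

instance : (completion' M F).IsClosedUnderIsomorphisms where
  of_iso := by
    rintro X Y e ⟨⟨E, hE, h, ⟨e'⟩⟩, hX⟩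
    exact ⟨⟨E, hE, h, ⟨e.symm ≪≫ e'⟩⟩, (supported M F).prop_of_iso e hX⟩

open scoped ZeroObject in
/-- The zero object is the homotopy colimit of the zero sequence. -/
lemma completion'_zero [HasCoproducts.{w} T] (hF : IsGoodExtension M F) :
    completion' M F (0 : T) := by
  let E : ℕ ⥤ S := (Functor.const ℕ).obj 0
  have hE : IsCauchy M E := by
    intro i j
    refine ⟨0, fun m m' _ h D g δ hD => M.prop_of_isZero i ?_⟩
    refine (shiftFunctor S j).map_isZero ?_
    exact (Triangle.isZero₃_iff_isIso₁ _ hD).2 (inferInstanceAs (IsIso (𝟙 (0 : S))))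
  let α : SeqCocone F E (0 : T) := { app n := 0, w h := comp_zero }
  have hE₀ (n : ℕ) : IsZero (F.obj (E.obj n)) := F.map_isZero (isZero_zero S)
  have hα : IsSupportedColimit M α := fun A hA =>
    ⟨fun g g' _ => (isZero_zero T).eq_of_src _ _, fun γ => ⟨0, by
      ext n
      exact (hE₀ n).eq_of_src _ _⟩⟩
  have hα' : α.IsYonedaColimit := fun s =>
    ⟨fun x => ⟨0, 0, (isZero_zero T).eq_of_tgt _ _⟩,
      fun n f _ => ⟨n, le_rfl, (isZero_zero S).eq_of_tgt _ _⟩⟩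
  have h₀ : supported M F (0 : T) :=
    supported_iff.2 fun j => ⟨0, fun m _ f => (isZero_zero T).eq_of_tgt _ _⟩
  obtain ⟨h⟩ := nonempty_homotopyColimit.{w} (E ⋙ F)
  exact (hα.completion' hF hE h₀ h ((hα'.supported_iff (hF.isYonedaColimit hE h)).1 h₀)).1

open scoped ZeroObject in
lemma completion'_isTriangulated [IsTriangulated S] [HasCoproducts.{w} T]
    (hF : IsGoodExtension M F) : (completion' M F).IsTriangulated :=
  have : (completion' M F).ContainsZero := ⟨0, isZero_zero T, completion'_zero.{w} hF⟩
  have : (completion' M F).IsStableUnderShift ℤ :=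
    ⟨fun n => ⟨fun _ hX => completion'_shift.{w} hF hX n⟩⟩
  have : (completion' M F).IsTriangulatedClosed₃ := .mk' fun _ hX h₁ h₂ =>
    (exists_cauchy_triangles.{w} hF hX h₁ h₂).1
  have := ObjectProperty.IsTriangulatedClosed₂.of_isTriangulatedClosed₃ (P := completion' M F)
  ⟨⟩

/-! ### The equivalence -/

/-- `𝒴` maps `𝔏'(S) ∩ 𝒴⁻¹(ℭ(S))` to `𝔖(S)`. -/
lemma completion_of_completion' (hF : IsGoodExtension M F) {A : T} (hA : completion' M F A) :
    completion M ((restrictedYoneda F).obj A) := by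
  obtain ⟨⟨E, hE, h, ⟨e⟩⟩, hA⟩ := hA
  exact ⟨⟨E, hE, _, hF.isColimit E hE h, ⟨(restrictedYoneda F).mapIso e⟩⟩, hA⟩

/-- The homotopy colimit of a Cauchy sequence lies in `𝔏'(S) ∩ 𝒴⁻¹(ℭ(S))` if the colimit in `Mod S`
lies in `ℭ(S)`. -/
lemma completion'_homotopyColimit (hF : IsGoodExtension M F) {E : ℕ ⥤ S} (hE : IsCauchy M E)
    {c : Cocone (E ⋙ yonedaMod S)} (hc : IsColimit c) (hc' : compactlySupported M c.pt)
    (h : HomotopyColimit (E ⋙ F)) : completion' M F h.pt :=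
  ⟨⟨E, hE, h, ⟨Iso.refl _⟩⟩, (compactlySupported M).prop_of_iso
    (hc.coconePointUniqueUpToIso (hF.isColimit E hE h).some) hc'⟩

/-- The functor from `𝔏'(S) ∩ 𝒴⁻¹(ℭ(S))` to `𝔖(S)` induced by `𝒴`. -/
abbrev comparison (hY : ∀ A : (completion' M F).FullSubcategory,
    completion M ((restrictedYoneda F).obj A.obj)) :
    (completion' M F).FullSubcategory ⥤ (completion M).FullSubcategory :=
  (completion M).lift ((completion' M F).ι ⋙ restrictedYoneda F) hY

lemma comparison_isEquivalence [HasCoproducts.{w} T] (hF : IsGoodExtension M F)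
    (hY : ∀ A : (completion' M F).FullSubcategory,
      completion M ((restrictedYoneda F).obj A.obj)) : (comparison hY).IsEquivalence where
  faithful :=
    { map_injective {X Y f g} h := by
        obtain ⟨E, hE, α, hα, hα'⟩ := X.property.exists_seqCocone hF
        ext
        exact (hα'.bijective_map hα Y.property.2).1 (congrArg (fun k => k.hom) h) }
  full :=
    { map_surjective {X Y} f := by
        obtain ⟨E, hE, α, hα, hα'⟩ := X.property.exists_seqCocone hF
        obtain ⟨g, hg⟩ := (hα'.bijective_map hα Y.property.2).2 f.hom
        exact ⟨ObjectProperty.homMk g, by ext1; exact hg⟩ }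
  essSurj :=
    { mem_essImage := by
        rintro ⟨A, ⟨E, hE, c, ⟨hc⟩, ⟨e⟩⟩, hA⟩
        obtain ⟨h⟩ := nonempty_homotopyColimit.{w} (E ⋙ F)
        have := completion'_homotopyColimit hF hE hc ((compactlySupported M).prop_of_iso e hA) h
        exact ⟨⟨h.pt, this⟩, ⟨(completion M).fullyFaithfulι.preimageIso
          (((hF.isColimit E hE h).some.coconePointUniqueUpToIso hc) ≪≫ e.symm)⟩⟩ }

/-! ### Transporting the triangulated structure -/

section

variable {C : Type*} [Category* C]

/-- With `isCompatibleWithTriangulation_isomorphisms`, this makes the triangulated structure on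
localized categories available for transport along an equivalence, which is a localization with
respect to the isomorphisms. -/
instance hasLeftCalculusOfFractions_isomorphisms :
    (MorphismProperty.isomorphisms C).HasLeftCalculusOfFractions where
  exists_leftFraction X Y φ := by
    have : IsIso φ.s := φ.hs
    exact ⟨⟨inv φ.s ≫ φ.f, 𝟙 _, inferInstanceAs (IsIso (𝟙 Y))⟩, by simp⟩
  ext X' X Y f₁ f₂ s hs h := by
    have : IsIso s := hs
    exact ⟨Y, 𝟙 _, inferInstanceAs (IsIso (𝟙 Y)), by rw [(cancel_epi s).1 h]⟩

instance isCompatibleWithTriangulation_isomorphisms [HasShift C ℤ] [Preadditive C]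
    [HasZeroObject C] [∀ n : ℤ, (shiftFunctor C n).Additive] [Pretriangulated C] :
    (MorphismProperty.isomorphisms C).IsCompatibleWithTriangulation where
  condition n := by
    ext X Y f
    exact isIso_iff_of_reflects_iso f (shiftFunctor C n)
  compatible_with_triangulation T₁ T₂ hT₁ hT₂ a b ha hb comm := by
    obtain ⟨c, hc₁, hc₂⟩ := complete_distinguished_triangle_morphism _ _ hT₁ hT₂ a b comm
    exact ⟨c, isIso₃_of_isIso₁₂ (Triangle.homMk _ _ a b c comm hc₁ hc₂) hT₁ hT₂ ha hb, hc₁, hc₂⟩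

end

/-- The distinguished triangles of `𝔖(S)` are the images under `𝒴` of the distinguished triangles of
`𝔏'(S) ∩ 𝒴⁻¹(ℭ(S))`. -/
lemma essImageDistTriang_comparison [IsTriangulated S] [HasCoproducts.{w} T]
    (hF : IsGoodExtension M F) [(completion' M F).IsTriangulated]
    (hY : ∀ A : (completion' M F).FullSubcategory,
      completion M ((restrictedYoneda F).obj A.obj)) :
    (comparison hY).essImageDistTriang = completionTriangles M := by
  let e (X : Triangle (completion' M F).FullSubcategory) :
      (completion M).ι.mapTriangle.obj ((comparison hY).mapTriangle.obj X) ≅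
        (restrictedYoneda F).mapTriangle.obj ((completion' M F).ι.mapTriangle.obj X) :=
    ((Functor.mapTriangleCompIso (comparison hY) (completion M).ι).symm ≪≫
      Functor.mapTriangleIso ((completion M).liftCompιIso _ hY) ≪≫
      Functor.mapTriangleCompIso (completion' M F).ι (restrictedYoneda F)).app X
  ext X
  constructor
  · rintro ⟨X', e', hX'⟩
    obtain ⟨-, K, hK, h₁, h₂, h₃, α, β, γ, hα, hβ, hγ, comm₁, comm₂, comm₃⟩ :=
      exists_cauchy_triangles.{w} hF hX' X'.obj₁.property X'.obj₂.property
    exact ⟨K, hK, h₁, h₂, h₃, triangleCocone α β γ comm₁ comm₂ comm₃,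
      α.nonempty_isColimit_yonedaCocone_iff.2 hα, β.nonempty_isColimit_yonedaCocone_iff.2 hβ,
      γ.nonempty_isColimit_yonedaCocone_iff.2 hγ,
      ⟨(completion M).ι.mapTriangle.mapIso e' ≪≫ e X'⟩⟩
  · rintro ⟨K, hK, h₁, h₂, h₃, c, ⟨hc₁⟩, ⟨hc₂⟩, ⟨hc₃⟩, ⟨e'⟩⟩
    -- the cone in `T` of the map of homotopy colimits is the homotopy colimit of the cones, and its
    -- image under `𝒴` has the same three components as the given triangle
    obtain ⟨a⟩ := nonempty_homotopyColimit.{w} ((K ⋙ Triangle.π₁) ⋙ F)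
    obtain ⟨b⟩ := nonempty_homotopyColimit.{w} ((K ⋙ Triangle.π₂) ⋙ F)
    have ha : completion' M F a.pt := completion'_homotopyColimit hF h₁ hc₁
      ((compactlySupported M).prop_of_iso (Triangle.π₁.mapIso e') X.obj₁.property.2) a
    have hb : completion' M F b.pt := completion'_homotopyColimit hF h₂ hc₂
      ((compactlySupported M).prop_of_iso (Triangle.π₂.mapIso e') X.obj₂.property.2) b
    have ha' := isSupportedColimit_homotopyColimit h₁ a
    obtain ⟨f, hf⟩ := ha'.exists_desc hb.2
      (b.seqCocone.precomp (Functor.whiskerLeft K Triangle.π₁Toπ₂))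
    let f' : (⟨a.pt, ha⟩ : (completion' M F).FullSubcategory) ⟶ ⟨b.pt, hb⟩ :=
      ObjectProperty.homMk f
    obtain ⟨C, g, δ, hT⟩ := distinguished_cocone_triangle f'
    obtain ⟨γ, comm₂, comm₃, hγ, -⟩ := exists_colimit_seqCocone₃.{w} hF hK h₁ h₂ h₃ hT ha.2 hb.2
      ha' (hF.isYonedaColimit h₁ a) (isSupportedColimit_homotopyColimit h₂ b)
      (hF.isYonedaColimit h₂ b) (fun n => (hf n).symm)
    obtain ⟨e''⟩ := nonempty_iso_of_isColimit hc₁ hc₂ hc₃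
      (c' := triangleCocone a.seqCocone b.seqCocone γ (fun n => (hf n).symm) comm₂ comm₃)
      (a.seqCocone.nonempty_isColimit_yonedaCocone_iff.2 (hF.isYonedaColimit h₁ a)).some
      (b.seqCocone.nonempty_isColimit_yonedaCocone_iff.2 (hF.isYonedaColimit h₂ b)).some
      (γ.nonempty_isColimit_yonedaCocone_iff.2 hγ).some
    exact ⟨Triangle.mk f' g δ, (completion M).ι.mapTriangle.preimageIso
      (e' ≪≫ e'' ≪≫ (e (Triangle.mk f' g δ)).symm), hT⟩

end

end MetricCompletion

theorem mainTheorem2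
    {S : Type u₁} [Category.{v} S] [Preadditive S] [HasZeroObject S] [HasShift S ℤ]
    [∀ n : ℤ, (shiftFunctor S n).Additive] [Pretriangulated S] [IsTriangulated S]
    {T : Type u₂} [Category.{v} T] [Preadditive T] [HasZeroObject T] [HasShift T ℤ]
    [∀ n : ℤ, (shiftFunctor T n).Additive] [Pretriangulated T] [IsTriangulated T]
    [HasCoproducts.{w} T]
    (M : MetricCompletion.Metric S) (F : S ⥤ T) [F.CommShift ℤ] [F.IsTriangulated]
    (hF : MetricCompletion.IsGoodExtension M F) :
    ∃ (_ : (MetricCompletion.completion' M F).IsTriangulated)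
      (_ : Pretriangulated (MetricCompletion.completion M).FullSubcategory)
      (hY : ∀ A : (MetricCompletion.completion' M F).FullSubcategory,
        MetricCompletion.completion M ((MetricCompletion.restrictedYoneda F).obj A.obj)),
      (MetricCompletion.completion' M F).IsClosedUnderIsomorphisms ∧
      distTriang (MetricCompletion.completion M).FullSubcategory =
        MetricCompletion.completionTriangles M ∧
      IsTriangulated (MetricCompletion.completion M).FullSubcategory ∧
      ((MetricCompletion.completion M).lift
        ((MetricCompletion.completion' M F).ι ⋙ MetricCompletion.restrictedYoneda F)
          hY).IsEquivalence ∧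
      ((MetricCompletion.completion M).lift
        ((MetricCompletion.completion' M F).ι ⋙ MetricCompletion.restrictedYoneda F)
          hY).IsTriangulated := by
  have h₁ := MetricCompletion.completion'_isTriangulated.{w} hF
  let hY (A : (MetricCompletion.completion' M F).FullSubcategory) :=
    MetricCompletion.completion_of_completion' hF A.property
  have hE := MetricCompletion.comparison_isEquivalence.{w} hF hY
  -- the triangulated structure on `𝔖(S)` is the one of a localization with respect to the
  -- isomorphisms
  have hL : (MetricCompletion.comparison hY).IsLocalization (MorphismProperty.isomorphisms _) :=
    Functor.IsLocalization.of_isEquivalence _ _ le_rfl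
  have hA : (MetricCompletion.comparison hY).Additive :=
    ⟨by intros; ext1; exact (MetricCompletion.restrictedYoneda F).map_add⟩
  let P := Triangulated.Localization.pretriangulated (MetricCompletion.comparison hY)
    (MorphismProperty.isomorphisms _)
  refine ⟨h₁, P, hY, inferInstance, MetricCompletion.essImageDistTriang_comparison.{w} hF hY,
    Triangulated.Localization.isTriangulated (MetricCompletion.comparison hY)
      (MorphismProperty.isomorphisms _), hE, ?_⟩
  exact Triangulated.Localization.isTriangulated_functor (MetricCompletion.comparison hY)
    (MorphismProperty.isomorphisms _)
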